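/- Let $r \ge 1$ and $n \ge 0$ be integers, let $\boldsymbol\lambda = (\lambda^{(1)},\dots,\lambda^{(r)})$ be an $r$-tuple of partitions with $\sum_{i=1}^r |\lambda^{(i)}| = n$, and let $\nu$ be a partition of $n$. For a partition $\mu$ let $s_\mu = \sum_T y^{T}$ be the Schur function in the variables $y_1, y_2, \dots$, where $T$ runs over the semistandard tableaux of shape $\mu$ with entries in $\{1,2,\dots\}$ and $y^T = \prod_k y_k^{m_k(T)}$, with $m_k(T)$ the number of entries of $T$ equal to $k$. Let $\lambda^{(1)} * \cdots * \lambda^{(r)}$ be the skew diagram formed from the diagrams of $\lambda^{(1)},\dots,\lambda^{(r)}$ by placing, for $i<k$, the diagram of $\lambda^{(i)}$ above all rows and to the right of all columns of that of $\lambda^{(k)}$, with no empty rows or columns in between. A semistandard tableau of shape $\boldsymbol\lambda$ is an $r$-tuple $T = (T^{(1)},\dots,T^{(r)})$ in which $T^{(i)}$ is a semistandard tableau of shape $\lambda^{(i)}$ with entries in $\{1,\dots,n\}$; it is regarded as a filling $\widetilde T$ of $\lambda^{(1)} * \cdots * \lambda^{(r)}$. It has weight $\nu = (\nu_1,\nu_2,\dots)$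 if, for every $k \ge 1$, exactly $\nu_k$ entries of $\widetilde T$ are equal to $k$. Its word $w(T)$ is obtained by reading the entries of $\widetilde T$ from right to left in successive rows, starting with the top row. A word is a lattice permutation if, for every $k \ge 1$, each of its initial segments contains at least as many letters $k$ as letters $k+1$. Let $SST^0(\boldsymbol\lambda,\nu)$ be the set of semistandard tableaux of shape $\boldsymbol\lambda$ and weight $\nu$ whose word is a lattice permutation. Then there is exactly one family of integers $c^{\mu}_{\lambda^{(1)},\dots,\lambda^{(r)}}$, indexed by all partitions $\mu$ and zero for all but finitely many $\mu$, such that $$s_{\lambda^{(1)}} \cdots s_{\lambda^{(r)}} = \sum_{\mu} c^{\mu}_{\lambda^{(1)},\dots,\lambda^{(r)}}\, s_\mu ,$$ and $$|SST^0(\boldsymbol\lambda,\nu)| = c^{\nu}_{\lambda^{(1)},\dots,\lambda^{(r)}} .$$ -/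

import Mathlib

/-!
Partitions are Young diagrams (`YoungDiagram`), drawn in English notation: the cell `(i, j)` lies in
row `i` (counted downwards) and column `j` (counted to the right), both starting from `0`.
Letters are natural numbers starting from `0`: the natural number `k` is the `(k + 1)`-st letter,
and it corresponds to the variable `y_{k+1}`.
-/

/-- The number of cells of `S` in which the filling `f` has the entry `k`. -/
def fillingWeight (S : Finset (ℕ × ℕ)) (f : ℕ → ℕ → ℕ) (k : ℕ) : ℕ :=
  (S.filter fun p => f p.1 p.2 = k).card

/-- The word of a filling `f` of a finite set `S` of cells: the entries are read from right to left
in successive rows, starting with the top row. -/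
def fillingWord (S : Finset (ℕ × ℕ)) (f : ℕ → ℕ → ℕ) : List ℕ :=
  (List.range (S.sup Prod.fst + 1)).flatMap fun i =>
    ((List.range (S.sup Prod.snd + 1)).reverse.filter fun j => (i, j) ∈ S).map (f i)

/-- A word is a lattice permutation if in each of its initial segments every letter occurs at least
as often as the next letter. -/
def IsLatticePermutation (w : List ℕ) : Prop :=
  ∀ m k : ℕ, (w.take m).count (k + 1) ≤ (w.take m).count k

/-- The Schur function `s_μ` in the variables `y_1, y_2, …`, as a formal power series over `ℤ`:
the coefficient of `y^d` is the number of semistandard tableaux of shape `μ` and weight `d`. -/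
noncomputable def schurFunction (μ : YoungDiagram) : MvPowerSeries ℕ ℤ :=
  fun d : ℕ →₀ ℕ =>
    (Nat.card {T : SemistandardYoungTableau μ // ∀ k, fillingWeight μ.cells T k = d k} : ℤ)

/-- The integers `c μ`, zero for all but finitely many `μ`, are the coefficients of an expansion
`s_{λ^{(1)}} ⋯ s_{λ^{(r)}} = ∑_μ c μ • s_μ`. -/
def IsSchurExpansion {r : ℕ} (lam : Fin r → YoungDiagram) (c : YoungDiagram →₀ ℤ) : Prop :=
  ∏ i, schurFunction (lam i) = c.sum fun μ a => a • schurFunction μ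

open Classical in
/-- The coefficient `c^ν_{λ^{(1)}, …, λ^{(r)}}` of `s_ν` in the expansion of
`s_{λ^{(1)}} ⋯ s_{λ^{(r)}}` in Schur functions. -/
noncomputable def multiLRCoeff {r : ℕ} (lam : Fin r → YoungDiagram) (ν : YoungDiagram) : ℤ :=
  if h : ∃ c, IsSchurExpansion lam c then h.choose ν else 0

/-- In the skew diagram `λ^{(1)} * ⋯ * λ^{(r)}` the component `λ^{(i)}` lies below all rows of the
components `λ^{(k)}` with `k < i`. -/
def starRow {r : ℕ} (lam : Fin r → YoungDiagram) (i : Fin r) : ℕ :=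
  ∑ k with k < i, (lam k).colLen 0

/-- In the skew diagram `λ^{(1)} * ⋯ * λ^{(r)}` the component `λ^{(i)}` lies to the right of all
columns of the components `λ^{(k)}` with `k > i`. -/
def starCol {r : ℕ} (lam : Fin r → YoungDiagram) (i : Fin r) : ℕ :=
  ∑ k with i < k, (lam k).rowLen 0

/-- The cells of the skew diagram `λ^{(1)} * λ^{(2)} * ⋯ * λ^{(r)}`. -/
def starCells {r : ℕ} (lam : Fin r → YoungDiagram) : Finset (ℕ × ℕ) :=
  Finset.univ.biUnion fun i =>
    (lam i).cells.image fun p => (p.1 + starRow lam i, p.2 + starCol lam i)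

/-- Semistandard tableaux of shape `λ = (λ^{(1)}, …, λ^{(r)})`: `r`-tuples of semistandard tableaux
of shapes `λ^{(i)}`, with entries among the first `n` letters. -/
abbrev MultiSSYT {r : ℕ} (n : ℕ) (lam : Fin r → YoungDiagram) : Type :=
  {T : (i : Fin r) → SemistandardYoungTableau (lam i) // ∀ i, ∀ p ∈ lam i, T i p.1 p.2 < n}

/-- The filling of the skew diagram `λ^{(1)} * ⋯ * λ^{(r)}` obtained by placing the tableaux
`T^{(i)}` on its components. It vanishes outside the diagram, and at each cell of the diagram
exactly one component contributes to the sum, as `T^{(i)}` vanishes outside `λ^{(i)}`. -/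
def starFilling {r n : ℕ} {lam : Fin r → YoungDiagram} (T : MultiSSYT n lam) (a b : ℕ) : ℕ :=
  ∑ i, if starRow lam i ≤ a ∧ starCol lam i ≤ b then
    T.1 i (a - starRow lam i) (b - starCol lam i) else 0

/-- `SST(λ, ν)`: the semistandard tableaux of shape `λ = (λ^{(1)}, …, λ^{(r)})` and weight `ν`. -/
def SST {r : ℕ} (n : ℕ) (lam : Fin r → YoungDiagram) (ν : YoungDiagram) :
    Set (MultiSSYT n lam) :=
  {T | ∀ k, fillingWeight (starCells lam) (starFilling T) k = ν.rowLen k}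

/-- `SST⁰(λ, ν)`: the tableaux in `SST(λ, ν)` whose word, read off from the skew diagram
`λ^{(1)} * ⋯ * λ^{(r)}`, is a lattice permutation. -/
def SST0 {r : ℕ} (n : ℕ) (lam : Fin r → YoungDiagram) (ν : YoungDiagram) :
    Set (MultiSSYT n lam) :=
  {T | T ∈ SST n lam ν ∧ IsLatticePermutation (fillingWord (starCells lam) (starFilling T))}

/-!
The proof counts words. For a semistandard filling of a skew diagram, read its entries from right
to left in successive rows, and let `excess k` be the number of letters `k` of a word minus its
number of letters `k + 1`; a word is a lattice permutation when all its prefixes have nonnegative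
excess for every `k`. The set of reading words of the semistandard fillings of a skew diagram is
closed under the crystal operators `e_k` and `f_k`, which change one letter where the prefix
excesses attain their minimum (`isCrystal_fillingWord`). Moving along crystal strings while fixing
an initial segment `u` of the words shows that the number of words beginning with `u` is invariant
under a reflection of the weight (`card_wordsWithPrefix_reflect`). For empty `u` this is the
symmetry of the weight multiplicities `K(d)`. If `u` is the first prefix of a word at which the lattice
condition fails, at the letter `k + 1`, it is the reflection `s_k` of the dot action, which fixes
`-ρ`.

Hence, in the alternating sum of `K(σ · (ν + ρ) - ρ)` over all permutations `σ` of the letters, the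
words violating the lattice condition cancel according to their first failure, and for dominant `ν`
only the lattice permutations of weight `ν` remain
(`sum_sign_card_words_eq_card_latticeWords`). A straight shape `μ` has a single lattice tableau, of
weight `μ` (`card_latticeWords_tableauWords`), so on any expansion of a product in Schur functions
the alternating sum extracts the coefficient of `s_ν`. The coefficients of the product
`s_{λ^{(1)}} ⋯ s_{λ^{(r)}}` are the weight multiplicities of the skew diagram
`λ^{(1)} * ⋯ * λ^{(r)}` (`coeff_prod_schurFunction`), so the coefficient of `s_ν` is the number of
lattice tableaux of weight `ν`: this gives uniqueness and the value of the coefficient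
(`IsSchurExpansion.eq_card_latticeWords`).

For existence, the difference between the product and the sum of Schur functions with these
coefficients is symmetric and all its alternating sums vanish. Such a function is zero, by induction
on the moment `∑ i * d i` of the weight `d` (`eq_zero_of_sum_sign_dotAction_eq_zero`).
-/

/-! ### Prefix excesses of words -/

/-- The letters `k` of a word are counted with sign `+1` and the letters `k + 1` with sign `-1`. As
a function of the letter, `letterSign k` is also the simple root `ε_k - ε_{k+1}` of type `A`. -/
def letterSign (k a : ℕ) : ℤ :=
  (if a = k then 1 else 0) - if a = k + 1 then 1 else 0

/-- The number of letters `k` of a word minus its number of letters `k + 1`. A word is a lattice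
permutation when the excesses of all its prefixes are nonnegative. -/
def excess (k : ℕ) (w : List ℕ) : ℤ :=
  (w.count k : ℤ) - w.count (k + 1)

theorem letterSign_self (k : ℕ) : letterSign k k = 1 := by simp [letterSign]

theorem letterSign_succ (k : ℕ) : letterSign k (k + 1) = -1 := by simp [letterSign]

theorem letterSign_of_ne {k i : ℕ} (h : i ≠ k) (h' : i ≠ k + 1) : letterSign k i = 0 := by
  simp [letterSign, h, h']

theorem letterSign_pos {k a : ℕ} (h : 0 < letterSign k a) : a = k := by
  unfold letterSign at h; split_ifs at h <;> first | assumption | omega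

theorem letterSign_neg {k a : ℕ} (h : letterSign k a < 0) : a = k + 1 := by
  unfold letterSign at h; split_ifs at h <;> first | assumption | omega

theorem neg_one_le_letterSign (k a : ℕ) : -1 ≤ letterSign k a := by
  unfold letterSign; split_ifs <;> omega

@[simp] theorem excess_nil (k : ℕ) : excess k [] = 0 := by simp [excess]

theorem isLatticePermutation_iff {w : List ℕ} :
    IsLatticePermutation w ↔ ∀ m k, 0 ≤ excess k (w.take m) := by
  simp [IsLatticePermutation, excess]

theorem excess_take_succ {k m a : ℕ} {w : List ℕ} (h : w[m]? = some a) :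
    excess k (w.take (m + 1)) = excess k (w.take m) + letterSign k a := by
  rw [List.take_add_one, h]
  simp only [excess, Option.toList_some, List.count_append, List.count_singleton, letterSign,
    beq_iff_eq]
  push_cast
  ring

theorem count_set_cast {w : List ℕ} {m a b i : ℕ} (h : w[m]? = some a) :
    ((w.set m b).count i : ℤ) =
      w.count i - (if i = a then 1 else 0) + if i = b then 1 else 0 := by
  obtain ⟨hm, rfl⟩ := List.getElem?_eq_some_iff.1 h
  rw [List.count_set hm]
  have hpos : w[m] = i → 0 < w.count i := fun e => e ▸ List.count_pos_iff.2 (List.getElem_mem hm)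
  by_cases e : w[m] = i
  · have := hpos e
    simp only [e, beq_self_eq_true, if_true, beq_iff_eq, eq_comm (a := i)]
    split_ifs <;> push_cast [Nat.cast_sub this] <;> simp
  · simp only [beq_iff_eq, e, Ne.symm e, if_false, eq_comm (a := b)]
    push_cast; simp

theorem excess_set {w : List ℕ} {k m a b : ℕ} (h : w[m]? = some a) :
    excess k (w.set m b) = excess k w - letterSign k a + letterSign k b := by
  simp only [excess, count_set_cast h, letterSign, eq_comm (a := k), eq_comm (a := k + 1)]
  ring

theorem excess_take_set_of_lt {w : List ℕ} {k m j a b : ℕ} (h : w[m]? = some a) (hj : m < j) :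
    excess k ((w.set m b).take j) = excess k (w.take j) - letterSign k a + letterSign k b := by
  rw [List.take_set, excess_set]
  rw [List.getElem?_take_of_lt hj, h]

/-! ### Crystal operators on words -/

/-- `m` is the position at which the crystal operator `f_k` changes the letter `k` of `w` into
`k + 1`: the letter read right after the last minimum of the prefix excesses. -/
def IsLoweringPosition (k : ℕ) (w : List ℕ) (m : ℕ) : Prop :=
  w[m]? = some k ∧ (∀ j ≤ m, excess k (w.take m) ≤ excess k (w.take j)) ∧
    ∀ j, m < j → excess k (w.take m) < excess k (w.take j)

/-- `m` is the position at which the crystal operator `e_k` changes the letter `k + 1` of `w` into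
`k`: the letter whose reading attains the minimum of the prefix excesses for the first time. -/
def IsRaisingPosition (k : ℕ) (w : List ℕ) (m : ℕ) : Prop :=
  w[m]? = some (k + 1) ∧ (∀ j ≤ m, excess k (w.take (m + 1)) < excess k (w.take j)) ∧
    ∀ j, m < j → excess k (w.take (m + 1)) ≤ excess k (w.take j)

/-- A set of words that is closed under all crystal operators `e_k` and `f_k`. -/
structure IsCrystal (W : Set (List ℕ)) : Prop where
  lower_mem : ∀ {w k m}, w ∈ W → IsLoweringPosition k w m → w.set m (k + 1) ∈ W
  raise_mem : ∀ {w k m}, w ∈ W → IsRaisingPosition k w m → w.set m k ∈ W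

theorem IsLoweringPosition.lt_length {k m : ℕ} {w : List ℕ} (h : IsLoweringPosition k w m) :
    m < w.length := (List.getElem?_eq_some_iff.1 h.1).1

theorem IsRaisingPosition.lt_length {k m : ℕ} {w : List ℕ} (h : IsRaisingPosition k w m) :
    m < w.length := (List.getElem?_eq_some_iff.1 h.1).1

theorem IsLoweringPosition.excess_set_take {k m j : ℕ} {w : List ℕ}
    (h : IsLoweringPosition k w m) (hj : m < j) :
    excess k ((w.set m (k + 1)).take j) = excess k (w.take j) - 2 := by
  rw [excess_take_set_of_lt h.1 hj, letterSign_self, letterSign_succ]; ring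

theorem IsRaisingPosition.excess_set_take {k m j : ℕ} {w : List ℕ}
    (h : IsRaisingPosition k w m) (hj : m < j) :
    excess k ((w.set m k).take j) = excess k (w.take j) + 2 := by
  rw [excess_take_set_of_lt h.1 hj, letterSign_self, letterSign_succ]; ring

theorem IsLoweringPosition.isRaisingPosition {k m : ℕ} {w : List ℕ}
    (h : IsLoweringPosition k w m) : IsRaisingPosition k (w.set m (k + 1)) m := by
  have h1 := excess_take_succ (k := k) h.1
  rw [letterSign_self] at h1
  refine ⟨List.getElem?_set_self h.lt_length, fun j hj => ?_, fun j hj => ?_⟩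
  · rw [h.excess_set_take m.lt_add_one, List.take_set_of_le hj]
    have := h.2.1 j hj
    omega
  · rw [h.excess_set_take m.lt_add_one, h.excess_set_take hj]
    have := h.2.2 j hj
    omega

theorem IsRaisingPosition.isLoweringPosition {k m : ℕ} {w : List ℕ}
    (h : IsRaisingPosition k w m) : IsLoweringPosition k (w.set m k) m := by
  have h1 := excess_take_succ (k := k) h.1
  rw [letterSign_succ] at h1
  refine ⟨List.getElem?_set_self h.lt_length, fun j hj => ?_, fun j hj => ?_⟩
  · rw [List.take_set_of_le le_rfl, List.take_set_of_le hj]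
    have := h.2.1 j hj
    omega
  · rw [h.excess_set_take hj, List.take_set_of_le le_rfl]
    have := h.2.2 j hj
    omega

theorem set_set_of_getElem? {w : List ℕ} {m a b : ℕ} (h : w[m]? = some a) :
    (w.set m b).set m a = w := by
  obtain ⟨hm, rfl⟩ := List.getElem?_eq_some_iff.1 h
  simp

theorem IsLoweringPosition.unique {k m m' : ℕ} {w : List ℕ} (h : IsLoweringPosition k w m)
    (h' : IsLoweringPosition k w m') : m = m' := by
  rcases lt_trichotomy m m' with hlt | rfl | hlt
  · have := h.2.2 _ hlt
    have := h'.2.1 _ hlt.le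
    omega
  · rfl
  · have := h'.2.2 _ hlt
    have := h.2.1 _ hlt.le
    omega

theorem IsRaisingPosition.unique {k m m' : ℕ} {w : List ℕ} (h : IsRaisingPosition k w m)
    (h' : IsRaisingPosition k w m') : m = m' := by
  rcases lt_trichotomy m m' with hlt | rfl | hlt
  · have := h.2.2 (m' + 1) (by omega)
    have := h'.2.1 (m + 1) hlt
    omega
  · rfl
  · have := h'.2.2 (m + 1) (by omega)
    have := h.2.1 (m' + 1) hlt
    omega

theorem exists_isLoweringPosition {k : ℕ} {w : List ℕ} {p : ℤ}
    (hmin : ∀ j, -p ≤ excess k (w.take j)) (hatt : ∃ j, excess k (w.take j) = -p)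
    (hw : -p < excess k w) :
    ∃ m, IsLoweringPosition k w m ∧ excess k (w.take m) = -p := by
  classical
  have hlen : ∀ j, excess k (w.take j) = -p → j < w.length := by
    intro j hj
    by_contra hlt
    rw [List.take_of_length_le (not_lt.1 hlt)] at hj
    omega
  obtain ⟨j, hj⟩ := hatt
  set m := Nat.findGreatest (fun j => excess k (w.take j) = -p) w.length
  have hm : excess k (w.take m) = -p :=
    Nat.findGreatest_spec (P := fun j => excess k (w.take j) = -p) (hlen j hj).le hj
  have hlast : ∀ j, m < j → -p < excess k (w.take j) := by
    intro j hj
    refine lt_of_le_of_ne (hmin j) fun e => ?_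
    exact Nat.findGreatest_is_greatest hj (hlen j e.symm).le e.symm
  have hml := hlen m hm
  have hget : w[m]? = some w[m] := List.getElem?_eq_getElem hml
  have hstep := excess_take_succ (k := k) hget
  have := hlast (m + 1) (Nat.lt_succ_self m)
  have hk := letterSign_pos (k := k) (a := w[m]) (by omega)
  refine ⟨m, ⟨by rw [hget, hk], fun j _ => ?_, fun j hj => ?_⟩, hm⟩
  · rw [hm]; exact hmin j
  · rw [hm]; exact hlast j hj

theorem exists_isRaisingPosition {k : ℕ} {w : List ℕ} {p : ℤ}
    (hmin : ∀ j, -p ≤ excess k (w.take j)) (hatt : ∃ j, excess k (w.take j) = -p) (hp : 0 < p) :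
    ∃ m, IsRaisingPosition k w m ∧ excess k (w.take (m + 1)) = -p := by
  classical
  obtain ⟨n, hn, hfirst⟩ : ∃ n, excess k (w.take n) = -p ∧
      ∀ j < n, excess k (w.take j) ≠ -p :=
    ⟨Nat.find hatt, Nat.find_spec hatt, fun j hj => Nat.find_min hatt hj⟩
  cases n with
  | zero => simp at hn; omega
  | succ m =>
    have hlt : ∀ j ≤ m, -p < excess k (w.take j) := fun j hj =>
      lt_of_le_of_ne (hmin j) (Ne.symm (hfirst j (by omega)))
    have hm : m < w.length := by
      by_contra hge
      have := hlt m le_rfl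
      rw [List.take_of_length_le (by omega)] at hn this
      omega
    have hget : w[m]? = some w[m] := List.getElem?_eq_getElem hm
    have hstep := excess_take_succ (k := k) hget
    have := hlt m le_rfl
    have hk := letterSign_neg (k := k) (a := w[m]) (by omega)
    refine ⟨m, ⟨by rw [hget, hk], fun j hj => ?_, fun j _ => ?_⟩, hn⟩
    · rw [hn]; exact hlt j hj
    · rw [hn]; exact hmin j

/-! ### Reflections along crystal strings -/

/-- The words in `W` with letter multiplicities `d` that begin with `u`. Multiplicities are taken
in `ℤ`, so that reflected weights need no nonnegativity conditions. -/
def wordsWithPrefix (W : Set (List ℕ)) (u : List ℕ) (d : ℕ → ℤ) : Set (List ℕ) :=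
  {w | w ∈ W ∧ u <+: w ∧ ∀ i, (w.count i : ℤ) = d i}

/-- The words in `wordsWithPrefix W u d` for which the minimum of the prefix excesses is `-p`;
equivalently, `p` letters `k + 1` stay unmatched when every letter `k + 1` is bracketed with an
earlier letter `k`. -/
def crystalFibre (W : Set (List ℕ)) (u : List ℕ) (k : ℕ) (d : ℕ → ℤ) (p : ℤ) : Set (List ℕ) :=
  {w | w ∈ wordsWithPrefix W u d ∧ (∀ j, -p ≤ excess k (w.take j)) ∧
    ∃ j, excess k (w.take j) = -p}

theorem nonempty_equiv_of_rel {α : Type*} {A B : Set α} (R : α → α → Prop)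
    (hA : ∀ a ∈ A, ∃ b ∈ B, R a b) (hB : ∀ b ∈ B, ∃ a ∈ A, R a b)
    (uA : ∀ a b b', R a b → R a b' → b = b') (uB : ∀ a a' b, R a b → R a' b → a = a') :
    Nonempty (A ≃ B) := by
  choose f hf hRf using hA
  choose g hg hRg using hB
  exact ⟨{
    toFun := fun a => ⟨f a a.2, hf a a.2⟩
    invFun := fun b => ⟨g b b.2, hg b b.2⟩
    left_inv := fun a => Subtype.ext (uB _ _ _ (hRg _ _) (hRf _ _))
    right_inv := fun b => Subtype.ext (uA _ _ _ (hRf _ _) (hRg _ _)) }⟩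

theorem excess_of_count {w : List ℕ} {d : ℕ → ℤ} (h : ∀ i, (w.count i : ℤ) = d i) (k : ℕ) :
    excess k w = d k - d (k + 1) := by
  rw [excess, h, h]

theorem take_eq_of_prefix {u w : List ℕ} (h : u <+: w) {j : ℕ} (hj : j ≤ u.length) :
    w.take j = u.take j := by
  obtain ⟨v, rfl⟩ := h
  rw [List.take_append_of_le_length hj]

theorem prefix_set_of_prefix {u w : List ℕ} (h : u <+: w) {m a : ℕ} (hm : u.length ≤ m) :
    u <+: w.set m a := by
  obtain ⟨v, rfl⟩ := h
  rw [List.set_append_right _ _ hm]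
  exact List.prefix_append _ _

/-- One step along a crystal string. The hypotheses on `u` say that its prefix excesses are too
large for `f_k` and its inverse to act inside `u`. -/
theorem nonempty_crystalFibre_equiv_succ {W : Set (List ℕ)} (hW : IsCrystal W) {u : List ℕ}
    {k : ℕ} {d : ℕ → ℤ} {p : ℤ} (hu : ∀ j < u.length, -p < excess k (u.take j))
    (hu' : -p ≤ excess k u) (hq : 0 < p + (d k - d (k + 1))) :
    Nonempty (crystalFibre W u k d p ≃
      crystalFibre W u k (fun i => d i - letterSign k i) (p + 1)) := by
  have hu0 : 0 ≤ p := by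
    cases u with
    | nil => simpa using hu'
    | cons a u => have := hu 0 (by simp); simp at this; omega
  refine nonempty_equiv_of_rel
    (fun w w' => ∃ m, IsLoweringPosition k w m ∧ w' = w.set m (k + 1)) ?_ ?_ ?_ ?_
  · rintro w ⟨⟨hwW, hpre, hd⟩, hmin, hatt⟩
    obtain ⟨m, hm, hmp⟩ := exists_isLoweringPosition hmin hatt
      (by rw [excess_of_count hd]; omega)
    have hm' := hm.isRaisingPosition
    have hum : u.length ≤ m := by
      by_contra hlt
      have := hu m (by omega)
      rw [← take_eq_of_prefix hpre (by omega)] at this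
      omega
    have hval : excess k ((w.set m (k + 1)).take (m + 1)) = -(p + 1) := by
      rw [hm.excess_set_take (Nat.lt_succ_self m), excess_take_succ hm.1, letterSign_self]
      omega
    refine ⟨w.set m (k + 1), ⟨⟨hW.lower_mem hwW hm, prefix_set_of_prefix hpre hum, fun i => ?_⟩,
      fun j => ?_, m + 1, hval⟩, m, hm, rfl⟩
    · rw [count_set_cast hm.1, hd]; simp only [letterSign]; ring
    · rcases le_or_gt j m with hj | hj
      · have := hm'.2.1 j hj; omega
      · have := hm'.2.2 j hj; omega
  · rintro w ⟨⟨hwW, hpre, hd⟩, hmin, hatt⟩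
    obtain ⟨m, hm, hmp⟩ := exists_isRaisingPosition hmin hatt (by omega)
    have hm' := hm.isLoweringPosition
    have hum : u.length ≤ m := by
      by_contra hlt
      have h1 := take_eq_of_prefix hpre (j := m + 1) (by omega)
      rw [h1] at hmp
      rcases Nat.lt_or_ge (m + 1) u.length with h2 | h2
      · have := hu _ h2; omega
      · rw [List.take_of_length_le h2] at hmp; omega
    have hval : excess k ((w.set m k).take m) = -p := by
      have := excess_take_succ (k := k) hm.1
      rw [List.take_set_of_le le_rfl]
      rw [letterSign_succ] at this
      omega
    refine ⟨w.set m k, ⟨⟨hW.raise_mem hwW hm, prefix_set_of_prefix hpre hum, fun i => ?_⟩,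
      fun j => ?_, m, hval⟩, m, hm', (set_set_of_getElem? hm.1).symm⟩
    · rw [count_set_cast hm.1, hd]; simp only [letterSign]; ring
    · rcases le_or_gt j m with hj | hj
      · have := hm'.2.1 j hj; omega
      · have := hm'.2.2 j hj; omega
  · rintro w _ _ ⟨m, hm, rfl⟩ ⟨m', hm', rfl⟩
    rw [hm.unique hm']
  · rintro w w' _ ⟨m, hm, rfl⟩ ⟨m', hm', h⟩
    have hr := hm.isRaisingPosition
    have hr' := hm'.isRaisingPosition
    rw [← h] at hr'
    obtain rfl := hr.unique hr'
    rw [← set_set_of_getElem? (b := k + 1) hm.1, h, set_set_of_getElem? hm'.1]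

theorem nonempty_crystalFibre_equiv_add {W : Set (List ℕ)} (hW : IsCrystal W) {u : List ℕ}
    {k : ℕ} {d : ℕ → ℤ} {p : ℤ} (hu : ∀ j < u.length, -p < excess k (u.take j))
    (hu' : -p ≤ excess k u) (t : ℕ) (ht : (t : ℤ) ≤ p + (d k - d (k + 1))) :
    Nonempty (crystalFibre W u k d p ≃
      crystalFibre W u k (fun i => d i - t * letterSign k i) (p + t)) := by
  induction t with
  | zero => simpa using ⟨Equiv.refl _⟩
  | succ t ih =>
    push_cast at ht
    obtain ⟨e⟩ := ih (by omega)
    obtain ⟨e'⟩ := nonempty_crystalFibre_equiv_succ hW (u := u) (k := k)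
      (d := fun i => d i - t * letterSign k i) (p := p + t)
      (fun j hj => by have := hu j hj; omega) (by omega)
      (by simp only [letterSign_self, letterSign_succ]; omega)
    refine ⟨e.trans (e'.trans (Equiv.setCongr ?_))⟩
    congr 1
    · funext i; push_cast; ring
    · push_cast; ring

/-- The words in `wordsWithPrefix W u d`, sorted by the minima of their prefix excesses. -/
noncomputable def sigmaCrystalFibreEquiv (W : Set (List ℕ)) (u : List ℕ) (k : ℕ) (d : ℕ → ℤ) :
    (Σ p : ℤ, crystalFibre W u k d p) ≃ wordsWithPrefix W u d := by
  refine Equiv.ofBijective (fun x => ⟨x.2.1, x.2.2.1⟩) ⟨?_, ?_⟩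
  · rintro ⟨p, w, hw, hmin, j, hj⟩ ⟨p', w', hw', hmin', j', hj'⟩ h
    obtain rfl : w = w' := congrArg Subtype.val h
    obtain rfl : p = p' := by
      have := hmin j'
      have := hmin' j
      omega
    rfl
  · rintro ⟨w, hw⟩
    obtain ⟨j, hj, hmin⟩ := Finset.exists_min_image (Finset.range (w.length + 1))
      (fun j => excess k (w.take j)) ⟨0, by simp⟩
    refine ⟨⟨-excess k (w.take j), w, hw, fun i => ?_, j, by simp⟩, rfl⟩
    rcases Nat.lt_or_ge i (w.length + 1) with hi | hi
    · simpa using hmin i (by simpa using hi)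
    · have := hmin w.length (by simp)
      rw [List.take_length] at this
      rw [List.take_of_length_le (i := i) (by omega)]
      simpa using this

theorem card_wordsWithPrefix_sub_of_nonneg {W : Set (List ℕ)} (hW : IsCrystal W) {u : List ℕ}
    {k : ℕ} {d : ℕ → ℤ} (hu : ∀ j < u.length, excess k u < excess k (u.take j)) (t : ℕ)
    (ht : (t : ℤ) = d k - d (k + 1) - excess k u) :
    Nat.card (wordsWithPrefix W u d) =
      Nat.card (wordsWithPrefix W u fun i => d i - t * letterSign k i) := by
  refine Nat.card_congr ((sigmaCrystalFibreEquiv W u k _).symm.trans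
    (Equiv.trans (Equiv.sigmaCongr (Equiv.addRight (t : ℤ)) fun p => ?_)
      (sigmaCrystalFibreEquiv W u k _)))
  refine Classical.choice ?_
  rcases le_or_gt (-p) (excess k u) with hp | hp
  · exact nonempty_crystalFibre_equiv_add hW (fun j hj => by have := hu j hj; omega) hp t
      (by omega)
  · -- both fibres are empty: their words would have too small a prefix excess
    have h1 : IsEmpty (crystalFibre W u k d p) := by
      refine ⟨fun ⟨w, ⟨_, hpre, _⟩, hmin, _⟩ => ?_⟩
      have := hmin u.length
      rw [take_eq_of_prefix hpre le_rfl, List.take_length] at this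
      omega
    have h2 : IsEmpty (crystalFibre W u k (fun i => d i - t * letterSign k i)
        (Equiv.addRight (t : ℤ) p)) := by
      refine ⟨fun ⟨w, ⟨_, hpre, hd⟩, hmin, _⟩ => ?_⟩
      have := hmin w.length
      rw [List.take_length, excess_of_count hd] at this
      simp only [letterSign_self, letterSign_succ, Equiv.coe_addRight] at this
      omega
    exact ⟨Equiv.equivOfIsEmpty _ _⟩

/-- Reflection along crystal strings: if `u` attains its minimal excess only at its end, the number
of words beginning with `u` is invariant under the reflection of weights in the hyperplane
`d_k - d_{k+1} = excess k u`. -/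
theorem card_wordsWithPrefix_reflect {W : Set (List ℕ)} (hW : IsCrystal W) {u : List ℕ}
    {k : ℕ} {d : ℕ → ℤ} (hu : ∀ j < u.length, excess k u < excess k (u.take j)) :
    Nat.card (wordsWithPrefix W u d) = Nat.card (wordsWithPrefix W u fun i =>
      d i - (d k - d (k + 1) - excess k u) * letterSign k i) := by
  rcases le_total 0 (d k - d (k + 1) - excess k u) with h | h
  · lift d k - d (k + 1) - excess k u to ℕ using h with t ht
    exact card_wordsWithPrefix_sub_of_nonneg hW hu t ht
  · set d' : ℕ → ℤ := fun i => d i - (d k - d (k + 1) - excess k u) * letterSign k i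
    have hd' : d' k - d' (k + 1) = 2 * excess k u - (d k - d (k + 1)) := by
      simp only [d', letterSign_self, letterSign_succ]; ring
    obtain ⟨t, ht⟩ := Int.eq_ofNat_of_zero_le (neg_nonneg.2 h)
    rw [card_wordsWithPrefix_sub_of_nonneg hW hu (d := d') t (by rw [hd']; omega)]
    congr 3
    funext i
    simp only [d', ← ht]
    ring

/-! ### Words whose prefixes are not lattice permutations -/

/-- The lattice permutations in `W` with letter multiplicities `d`. -/
def latticeWords (W : Set (List ℕ)) (d : ℕ → ℤ) : Set (List ℕ) :=
  {w | w ∈ W ∧ (∀ i, (w.count i : ℤ) = d i) ∧ IsLatticePermutation w}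

theorem finite_wordsWithPrefix (W : Set (List ℕ)) (u : List ℕ) (d : ℕ → ℤ) :
    (wordsWithPrefix W u d).Finite := by
  rcases (wordsWithPrefix W u d).eq_empty_or_nonempty with h | ⟨w₀, _, _, h₀⟩
  · rw [h]; exact Set.finite_empty
  · refine (w₀.permutations.toFinset.finite_toSet).subset fun w hw => ?_
    simp only [List.coe_toFinset, Set.mem_ofPred_eq, List.mem_permutations]
    rw [List.perm_iff_count]
    intro i
    have := hw.2.2 i
    have := h₀ i
    omega

/-- A word that is not a lattice permutation although all its proper prefixes are. -/
def IsFirstFailure (u : List ℕ) : Prop :=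
  (∃ k, excess k u < 0) ∧ ∀ j < u.length, ∀ k, 0 ≤ excess k (u.take j)

theorem exists_isFirstFailure {w : List ℕ} (h : ¬ IsLatticePermutation w) :
    ∃ u, u <+: w ∧ IsFirstFailure u := by
  classical
  have h' : ∃ m k, excess k (w.take m) < 0 := by
    simpa [isLatticePermutation_iff] using h
  refine ⟨w.take (Nat.find h'), List.take_prefix _ _, Nat.find_spec h', fun j hj k => ?_⟩
  rw [List.length_take] at hj
  have := Nat.find_min h' (m := j) (by omega)
  rw [List.take_take, min_eq_left (by omega)]
  by_contra hk
  exact this ⟨k, not_le.1 hk⟩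

theorem IsFirstFailure.not_isLatticePermutation {u w : List ℕ} (hu : IsFirstFailure u)
    (h : u <+: w) : ¬ IsLatticePermutation w := by
  rw [isLatticePermutation_iff]
  intro hl
  obtain ⟨k, hk⟩ := hu.1
  have := hl u.length k
  rw [take_eq_of_prefix h le_rfl, List.take_length] at this
  omega

theorem IsFirstFailure.length_le {u v w : List ℕ} (hu : IsFirstFailure u)
    (hv : IsFirstFailure v) (h : u <+: w) (h' : v <+: w) : v.length ≤ u.length := by
  by_contra hlt
  obtain ⟨k, hk⟩ := hu.1
  have := hv.2 u.length (by omega) k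
  rw [← take_eq_of_prefix h' (by omega), take_eq_of_prefix h le_rfl, List.take_length] at this
  omega

theorem IsFirstFailure.eq_of_prefix {u v w : List ℕ} (hu : IsFirstFailure u)
    (hv : IsFirstFailure v) (h : u <+: w) (h' : v <+: w) : u = v := by
  have hl := le_antisymm (hv.length_le hu h' h) (hu.length_le hv h h')
  rw [List.prefix_iff_eq_take] at h h'
  rw [h, h', hl]

theorem IsFirstFailure.excess_eq {u : List ℕ} (hu : IsFirstFailure u) {k : ℕ}
    (hk : excess k u < 0) : excess k u = -1 := by
  obtain ⟨n, hn⟩ : ∃ n, u.length = n + 1 := by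
    refine Nat.exists_eq_succ_of_ne_zero fun h0 => ?_
    rw [List.length_eq_zero_iff.1 h0] at hk
    simp at hk
  have h1 := excess_take_succ (k := k) (List.getElem?_eq_getElem (l := u) (i := n) (by omega))
  rw [List.take_of_length_le hn.le] at h1
  have := hu.2 n (by omega) k
  have := neg_one_le_letterSign k u[n]
  omega

/-- The shortest prefix of `w` that is not a lattice permutation, and `[]` if there is none. -/
noncomputable def firstFailure (w : List ℕ) : List ℕ := by
  classical
  exact if h : ∃ u, u <+: w ∧ IsFirstFailure u then h.choose else []

theorem firstFailure_spec {w : List ℕ} (h : ¬ IsLatticePermutation w) :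
    firstFailure w <+: w ∧ IsFirstFailure (firstFailure w) := by
  have h' := exists_isFirstFailure h
  rw [firstFailure, dif_pos h']
  exact h'.choose_spec

theorem IsFirstFailure.firstFailure_eq {u w : List ℕ} (hu : IsFirstFailure u) (h : u <+: w) :
    firstFailure w = u := by
  have hs := firstFailure_spec (hu.not_isLatticePermutation h)
  exact hs.2.eq_of_prefix hu hs.1 h

/-! ### The alternating sum over the dot action -/

/-- The weight `σ · (ν + ρ) - ρ` of type `A_{N-1}`, extended by zero to all letters. -/
def dotAction {N : ℕ} (ν : ℕ → ℤ) (σ : Equiv.Perm (Fin N)) (i : ℕ) : ℤ :=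
  if h : i < N then ν (σ ⟨i, h⟩) - (σ ⟨i, h⟩ : ℕ) + i else 0

theorem dotAction_of_lt {N : ℕ} (ν : ℕ → ℤ) (σ : Equiv.Perm (Fin N)) (i : Fin N) :
    dotAction ν σ i = ν (σ i) - (σ i : ℕ) + (i : ℕ) := by
  simp [dotAction]

theorem dotAction_of_le {N : ℕ} (ν : ℕ → ℤ) (σ : Equiv.Perm (Fin N)) {i : ℕ} (h : N ≤ i) :
    dotAction ν σ i = 0 := by
  simp [dotAction, not_lt.2 h]

theorem dotAction_one {N : ℕ} {ν : ℕ → ℤ} (hν : ∀ i, N ≤ i → ν i = 0) :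
    dotAction ν (1 : Equiv.Perm (Fin N)) = ν := by
  funext i
  rcases lt_or_ge i N with h | h
  · have := dotAction_of_lt ν (1 : Equiv.Perm (Fin N)) ⟨i, h⟩
    simpa using this
  · rw [dotAction_of_le _ _ h, hν i h]

theorem dotAction_mul_swap {N : ℕ} (ν : ℕ → ℤ) (σ : Equiv.Perm (Fin N)) {k : ℕ}
    (hk : k + 1 < N) :
    dotAction ν (σ * Equiv.swap ⟨k, by omega⟩ ⟨k + 1, hk⟩) = fun i =>
      dotAction ν σ i - (dotAction ν σ k - dotAction ν σ (k + 1) - (-1)) * letterSign k i := by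
  have h0 := dotAction_of_lt ν σ ⟨k, by omega⟩
  have h1 := dotAction_of_lt ν σ ⟨k + 1, hk⟩
  simp only at h0 h1
  funext i
  rcases lt_or_ge i N with h | h
  · have h2 := dotAction_of_lt ν (σ * Equiv.swap ⟨k, by omega⟩ ⟨k + 1, hk⟩) ⟨i, h⟩
    have h3 := dotAction_of_lt ν σ ⟨i, h⟩
    simp only [Equiv.Perm.mul_apply] at h2 h3
    rw [h2]
    rcases eq_or_ne i k with rfl | hik
    · rw [Equiv.swap_apply_left, letterSign_self, h0, h1]; push_cast; ring
    rcases eq_or_ne i (k + 1) with rfl | hik'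
    · rw [Equiv.swap_apply_right, letterSign_succ, h0, h1]; push_cast; ring
    · rw [Equiv.swap_apply_of_ne_of_ne (by simpa [Fin.ext_iff]) (by simpa [Fin.ext_iff]),
        letterSign_of_ne hik hik', h3]
      ring
  · rw [dotAction_of_le _ _ h, dotAction_of_le _ _ h, letterSign_of_ne (by omega) (by omega)]
    ring

/-- The words that fail first at a fixed prefix cancel in the alternating sum: reflection along
crystal strings matches the terms of `σ` and `σ s_k`. -/
theorem sum_sign_card_wordsWithPrefix_eq_zero {W : Set (List ℕ)} (hW : IsCrystal W) {u : List ℕ}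
    (hu : IsFirstFailure u) (N : ℕ) (ν : ℕ → ℤ) :
    ∑ σ : Equiv.Perm (Fin N), (Equiv.Perm.sign σ : ℤ) *
      Nat.card (wordsWithPrefix W u (dotAction ν σ)) = 0 := by
  obtain ⟨k, hk⟩ := hu.1
  have hk1 := hu.excess_eq hk
  rcases lt_or_ge (k + 1) N with hkN | hkN
  · have hne : (⟨k, by omega⟩ : Fin N) ≠ ⟨k + 1, hkN⟩ := by simp
    refine Finset.sum_involution (fun σ _ => σ * Equiv.swap ⟨k, by omega⟩ ⟨k + 1, hkN⟩)
      (fun σ _ => ?_) (fun σ _ _ h => ?_) (fun _ _ => Finset.mem_univ _) (fun σ _ => ?_)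
    · rw [dotAction_mul_swap, Equiv.Perm.sign_mul, Equiv.Perm.sign_swap hne, ← hk1,
        ← card_wordsWithPrefix_reflect hW
          (fun j hj => lt_of_lt_of_le hk (hu.2 j hj k))]
      simp
    · rw [mul_eq_left, Equiv.swap_eq_one_iff] at h
      exact hne h
    · rw [mul_assoc, Equiv.swap_mul_self, mul_one]
  · -- the letter `k + 1` of `u` is too large for all weights in the sum
    refine Finset.sum_eq_zero fun σ _ => ?_
    have : IsEmpty (wordsWithPrefix W u (dotAction ν σ)) := by
      refine ⟨fun ⟨w, _, hpre, hw⟩ => ?_⟩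
      have h1 := hw (k + 1)
      rw [dotAction_of_le _ _ hkN] at h1
      have h2 := hpre.sublist.count_le (k + 1)
      rw [excess] at hk
      omega
    simp

theorem latticeWords_eq_empty_of_lt {W : Set (List ℕ)} {d : ℕ → ℤ} {k : ℕ}
    (h : d k < d (k + 1)) : latticeWords W d = ∅ := by
  refine Set.eq_empty_of_forall_notMem fun w ⟨_, hd, hl⟩ => ?_
  have := isLatticePermutation_iff.1 hl w.length k
  rw [List.take_length, excess_of_count hd] at this
  omega

theorem latticeWords_dotAction_eq_empty {W : Set (List ℕ)} {N : ℕ} {ν : ℕ → ℤ}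
    (hanti : Antitone ν) {σ : Equiv.Perm (Fin N)} (hσ : σ ≠ 1) :
    latticeWords W (dotAction ν σ) = ∅ := by
  by_contra hne
  have hd : ∀ k, dotAction ν σ (k + 1) ≤ dotAction ν σ k := fun k => by
    by_contra h
    exact hne (latticeWords_eq_empty_of_lt (not_le.1 h))
  have hanti' : Antitone (dotAction ν σ) := antitone_nat_of_succ_le hd
  have hmono : StrictMono σ := by
    intro i j hij
    by_contra hle
    have h1 := hanti' (show (i : ℕ) ≤ j from hij.le)
    rw [dotAction_of_lt, dotAction_of_lt] at h1
    have h2 : ((σ j : Fin N) : ℕ) ≤ σ i := not_lt.1 hle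
    have h3 := hanti h2
    have h4 : (i : ℕ) < j := hij
    omega
  refine hσ (Equiv.ext fun i => ?_)
  have : (σ : Fin N → Fin N) = id :=
    (hmono.range_inj strictMono_id).1 (by rw [σ.surjective.range_eq, Set.range_id])
  exact congrFun this i

/-- In a crystal, the alternating sum of weight multiplicities over the dot action counts the
lattice permutations of a dominant weight. -/
theorem sum_sign_card_words_eq_card_latticeWords {W : Set (List ℕ)} (hW : IsCrystal W) {N : ℕ}
    {ν : ℕ → ℤ} (hanti : Antitone ν) (hν : ∀ i, N ≤ i → ν i = 0) :
    ∑ σ : Equiv.Perm (Fin N), (Equiv.Perm.sign σ : ℤ) *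
      Nat.card (wordsWithPrefix W [] (dotAction ν σ)) = Nat.card (latticeWords W ν) := by
  classical
  let Ω : Equiv.Perm (Fin N) → Finset (List ℕ) := fun σ =>
    (finite_wordsWithPrefix W [] (dotAction ν σ)).toFinset
  have hΩ : ∀ σ w, w ∈ Ω σ ↔ w ∈ wordsWithPrefix W [] (dotAction ν σ) := fun σ w => by
    simp [Ω]
  let B : Equiv.Perm (Fin N) → Finset (List ℕ) := fun σ =>
    (Ω σ).filter fun w => ¬ IsLatticePermutation w
  let U : Finset (List ℕ) := Finset.univ.biUnion fun σ => (B σ).image firstFailure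
  have hU : ∀ u ∈ U, IsFirstFailure u := by
    intro u hu
    simp only [U, B, Finset.mem_biUnion, Finset.mem_image, Finset.mem_filter] at hu
    obtain ⟨_, _, w, ⟨_, hw⟩, rfl⟩ := hu
    exact (firstFailure_spec hw).2
  have hsplit : ∀ σ : Equiv.Perm (Fin N), (Nat.card (wordsWithPrefix W [] (dotAction ν σ)) : ℤ) =
      Nat.card (latticeWords W (dotAction ν σ)) +
        ∑ u ∈ U, (Nat.card (wordsWithPrefix W u (dotAction ν σ)) : ℤ) := by
    intro σ
    have h1 : Nat.card (wordsWithPrefix W [] (dotAction ν σ)) = (Ω σ).card := by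
      rw [Nat.card_coe_set_eq, Set.ncard_eq_toFinset_card _ (finite_wordsWithPrefix W [] _)]
    have h2 : Nat.card (latticeWords W (dotAction ν σ)) =
        ((Ω σ).filter IsLatticePermutation).card := by
      rw [Nat.card_coe_set_eq, ← Set.ncard_coe_finset]
      congr 1
      ext w
      simp only [latticeWords, Finset.coe_filter, hΩ, wordsWithPrefix, Set.mem_ofPred_eq,
        List.nil_prefix, true_and, and_assoc]
    have h3 : ∀ u ∈ U, Nat.card (wordsWithPrefix W u (dotAction ν σ)) =
        ((B σ).filter fun w => firstFailure w = u).card := by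
      intro u hu
      rw [Nat.card_coe_set_eq, ← Set.ncard_coe_finset]
      congr 1
      ext w
      simp only [B, Finset.coe_filter, Finset.mem_filter, hΩ, wordsWithPrefix,
        Set.mem_ofPred_eq, List.nil_prefix, true_and]
      constructor
      · rintro ⟨hw, hpre, hd⟩
        exact ⟨⟨⟨hw, hd⟩, (hU u hu).not_isLatticePermutation hpre⟩,
          (hU u hu).firstFailure_eq hpre⟩
      · rintro ⟨⟨⟨hw, hd⟩, hl⟩, rfl⟩
        exact ⟨hw, (firstFailure_spec hl).1, hd⟩
    have h4 : (B σ).card = ∑ u ∈ U, ((B σ).filter fun w => firstFailure w = u).card := by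
      refine Finset.card_eq_sum_card_fiberwise fun w hw => ?_
      simp only [U, Finset.coe_biUnion, Set.mem_iUnion, Finset.coe_image]
      exact ⟨σ, by simp, w, hw, rfl⟩
    rw [h1, h2, Finset.sum_congr rfl fun u hu => by rw [h3 u hu],
      ← Finset.card_filter_add_card_filter_not (s := Ω σ) IsLatticePermutation]
    change ((_ + (B σ).card : ℕ) : ℤ) = _
    rw [h4]
    push_cast
    rfl
  simp_rw [hsplit, mul_add, Finset.sum_add_distrib, Finset.mul_sum]
  rw [Finset.sum_comm, Finset.sum_eq_zero (s := U) fun u hu =>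
    sum_sign_card_wordsWithPrefix_eq_zero hW (hU u hu) N ν, add_zero,
    Finset.sum_eq_single 1]
  · simp [dotAction_one hν]
  · intro σ _ hσ
    rw [latticeWords_dotAction_eq_empty hanti hσ]
    simp
  · simp

/-! ### Symmetry of weight multiplicities -/

/-- A weight of type `A_{N-1}`, extended by zero to all letters. -/
def extendWeight {N : ℕ} (d : Fin N → ℤ) (i : ℕ) : ℤ :=
  if h : i < N then d ⟨i, h⟩ else 0

theorem extendWeight_apply {N : ℕ} (d : Fin N → ℤ) (i : Fin N) : extendWeight d i = d i := by
  simp [extendWeight]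

theorem extendWeight_of_le {N : ℕ} (d : Fin N → ℤ) {i : ℕ} (h : N ≤ i) :
    extendWeight d i = 0 := by
  simp [extendWeight, not_lt.2 h]

theorem card_words_comp_swap {W : Set (List ℕ)} (hW : IsCrystal W) {n : ℕ}
    (d : Fin (n + 1) → ℤ) (k : Fin n) :
    Nat.card (wordsWithPrefix W [] (extendWeight (d ∘ Equiv.swap k.castSucc k.succ))) =
      Nat.card (wordsWithPrefix W [] (extendWeight d)) := by
  rw [card_wordsWithPrefix_reflect hW (u := []) (k := k) (d := extendWeight d) (by simp)]
  congr 3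
  have h0 := extendWeight_apply d k.castSucc
  have h1 := extendWeight_apply d k.succ
  simp only [Fin.val_castSucc, Fin.val_succ] at h0 h1
  funext i
  rw [excess_nil, sub_zero]
  rcases lt_or_ge i (n + 1) with h | h
  · have h2 := extendWeight_apply (d ∘ Equiv.swap k.castSucc k.succ) ⟨i, h⟩
    have h3 := extendWeight_apply d ⟨i, h⟩
    simp only [Function.comp_apply] at h2 h3
    rw [h2]
    rcases eq_or_ne i k with rfl | hik
    · have e : (⟨k, h⟩ : Fin (n + 1)) = k.castSucc := rfl
      rw [letterSign_self, h0, h1, e, Equiv.swap_apply_left]; ring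
    rcases eq_or_ne i (k + 1) with rfl | hik'
    · have e : (⟨k + 1, h⟩ : Fin (n + 1)) = k.succ := rfl
      rw [letterSign_succ, h0, h1, e, Equiv.swap_apply_right]; ring
    · rw [Equiv.swap_apply_of_ne_of_ne (by simpa [Fin.ext_iff]) (by simpa [Fin.ext_iff]),
        letterSign_of_ne hik hik', h3]
      ring
  · rw [extendWeight_of_le _ h, extendWeight_of_le _ h, letterSign_of_ne (by omega) (by omega)]
    ring

/-- Weight multiplicities of a crystal are invariant under permutations of the letters. -/
theorem card_words_comp_perm {W : Set (List ℕ)} (hW : IsCrystal W) {n : ℕ}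
    (d : Fin (n + 1) → ℤ) (σ : Equiv.Perm (Fin (n + 1))) :
    Nat.card (wordsWithPrefix W [] (extendWeight (d ∘ σ))) =
      Nat.card (wordsWithPrefix W [] (extendWeight d)) := by
  have hσ : σ ∈ Submonoid.closure (Set.range fun i : Fin n => Equiv.swap i.castSucc i.succ) := by
    rw [Equiv.Perm.mclosure_swap_castSucc_succ]; trivial
  induction hσ using Submonoid.closure_induction generalizing d with
  | mem x hx => obtain ⟨k, rfl⟩ := hx; exact card_words_comp_swap hW d k
  | one => rfl
  | mul x y _ _ hx hy =>
    have : d ∘ ⇑(x * y) = (d ∘ x) ∘ y := rfl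
    rw [this, hy, hx]

/-! ### Vanishing of symmetric functions -/

theorem sum_mul_perm_lt {N : ℕ} {σ : Equiv.Perm (Fin N)} (hσ : σ ≠ 1) :
    ∑ i : Fin N, ((i : ℕ) : ℤ) * (σ i : ℕ) < ∑ i : Fin N, ((i : ℕ) : ℤ) * (i : ℕ) := by
  have h1 : ∑ i : Fin N, ((σ i : ℕ) : ℤ) * (σ i : ℕ) = ∑ i : Fin N, ((i : ℕ) : ℤ) * (i : ℕ) :=
    Equiv.sum_comp σ fun i : Fin N => ((i : ℕ) : ℤ) * (i : ℕ)
  have h2 : 0 < ∑ i : Fin N, (((i : ℕ) : ℤ) - (σ i : ℕ)) ^ 2 := by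
    obtain ⟨i, hi⟩ : ∃ i, σ i ≠ i := by
      by_contra h
      push Not at h
      exact hσ (Equiv.ext h)
    refine Finset.sum_pos' (fun _ _ => sq_nonneg _) ⟨i, Finset.mem_univ _, ?_⟩
    have : ((i : ℕ) : ℤ) - (σ i : ℕ) ≠ 0 := by
      rw [sub_ne_zero]
      exact fun h => hi (Fin.ext (by exact_mod_cast h.symm))
    positivity
  have h3 : ∑ i : Fin N, (((i : ℕ) : ℤ) - (σ i : ℕ)) ^ 2 =
      ∑ i : Fin N, ((i : ℕ) : ℤ) * (i : ℕ) + ∑ i : Fin N, ((σ i : ℕ) : ℤ) * (σ i : ℕ) -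
        2 * ∑ i : Fin N, ((i : ℕ) : ℤ) * (σ i : ℕ) := by
    rw [Finset.mul_sum, ← Finset.sum_add_distrib, ← Finset.sum_sub_distrib]
    exact Finset.sum_congr rfl fun i _ => by ring
  omega

/-- A symmetric function of weights whose alternating sums over the dot action vanish at all
dominant weights is zero. Permuting a weight that is not dominant, and replacing a dominant weight
`ν` by a permutation of `σ · (ν + ρ) - ρ` with `σ ≠ 1`, both lower the moment `∑ i * d i`. -/
theorem eq_zero_of_sum_sign_dotAction_eq_zero {N : ℕ} (D : (ℕ → ℤ) → ℤ)
    (hneg : ∀ d i, d i < 0 → D d = 0)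
    (hsymm : ∀ (d : Fin N → ℤ) (σ : Equiv.Perm (Fin N)),
      D (extendWeight (d ∘ σ)) = D (extendWeight d))
    (hsum : ∀ ν : ℕ → ℤ, Antitone ν → (∀ i, 0 ≤ ν i) → (∀ i, N ≤ i → ν i = 0) →
      ∑ σ : Equiv.Perm (Fin N), (Equiv.Perm.sign σ : ℤ) * D (dotAction ν σ) = 0)
    (d : Fin N → ℤ) : D (extendWeight d) = 0 := by
  by_cases hd : ∀ i, 0 ≤ d i
  swap
  · push Not at hd
    obtain ⟨i, hi⟩ := hd
    exact hneg _ i (by rwa [extendWeight_apply])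
  obtain ⟨M, hM⟩ : ∃ M : ℕ, ∑ i : Fin N, ((i : ℕ) : ℤ) * d i = M :=
    Int.eq_ofNat_of_zero_le (Finset.sum_nonneg fun i _ => mul_nonneg (by positivity) (hd i))
  induction M using Nat.strong_induction_on generalizing d with
  | _ M ih =>
  have ih' : ∀ d' : Fin N → ℤ,
      ∑ i : Fin N, ((i : ℕ) : ℤ) * d' i < M → D (extendWeight d') = 0 := by
    intro d' hlt
    by_cases hd' : ∀ i, 0 ≤ d' i
    · obtain ⟨M', hM'⟩ : ∃ M' : ℕ, ∑ i : Fin N, ((i : ℕ) : ℤ) * d' i = M' :=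
        Int.eq_ofNat_of_zero_le
          (Finset.sum_nonneg fun i _ => mul_nonneg (by positivity) (hd' i))
      exact ih M' (by omega) d' hd' hM'
    · push Not at hd'
      obtain ⟨i, hi⟩ := hd'
      exact hneg _ i (by rwa [extendWeight_apply])
  by_cases hanti : Antitone d
  · have hanti' : Antitone (extendWeight d) := by
      intro i j hij
      rcases lt_or_ge j N with hj | hj
      · have h1 := extendWeight_apply d ⟨i, by omega⟩
        have h2 := extendWeight_apply d ⟨j, hj⟩
        simp only at h1 h2
        rw [h1, h2]
        exact hanti hij
      · rw [extendWeight_of_le d hj]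
        unfold extendWeight
        split_ifs
        · exact hd _
        · exact le_rfl
    have h0 := hsum _ hanti' (fun i => by
      unfold extendWeight; split_ifs; exacts [hd _, le_rfl]) fun i hi => extendWeight_of_le d hi
    rw [Finset.sum_eq_single 1] at h0
    · rwa [Equiv.Perm.sign_one, dotAction_one fun i hi => extendWeight_of_le d hi,
        Units.val_one, one_mul] at h0
    · intro σ _ hσ
      have hdot : dotAction (extendWeight d) σ =
          extendWeight ((fun j : Fin N => d j - (j : ℕ) + (σ⁻¹ j : ℕ)) ∘ σ) := by
        funext i
        rcases lt_or_ge i N with h | h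
        · have h1 := dotAction_of_lt (extendWeight d) σ ⟨i, h⟩
          have h2 := extendWeight_apply
            ((fun j : Fin N => d j - (j : ℕ) + (σ⁻¹ j : ℕ)) ∘ σ) ⟨i, h⟩
          simp only [extendWeight_apply, Function.comp_apply,
            Equiv.Perm.inv_def, Equiv.symm_apply_apply] at h1 h2
          rw [h1]
          exact h2.symm
        · rw [dotAction_of_le _ _ h, extendWeight_of_le _ h]
      rw [hdot, hsymm, ih', mul_zero]
      have := sum_mul_perm_lt (σ := σ⁻¹) (by simpa using hσ)
      simp only [mul_add, mul_sub, Finset.sum_add_distrib, Finset.sum_sub_distrib]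
      omega
    · simp
  · obtain ⟨i, j, hij, hlt⟩ : ∃ i j, i < j ∧ d i < d j := by
      simp only [Antitone, not_forall, not_le] at hanti
      obtain ⟨i, j, hij, hlt⟩ := hanti
      exact ⟨i, j, lt_of_le_of_ne hij fun e => by subst e; exact lt_irrefl _ hlt, hlt⟩
    rw [← hsymm d (Equiv.swap i j)]
    refine ih' _ ?_
    have h1 : ∑ x : Fin N, (((x : ℕ) : ℤ) * d x - ((x : ℕ) : ℤ) * (d ∘ Equiv.swap i j) x) =
        ((j : ℕ) - (i : ℕ)) * (d j - d i) := by
      rw [Fintype.sum_eq_add i j hij.ne]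
      · simp only [Function.comp_apply, Equiv.swap_apply_left, Equiv.swap_apply_right]; ring
      · rintro x ⟨hi, hj⟩
        rw [Function.comp_apply, Equiv.swap_apply_of_ne_of_ne hi hj, sub_self]
    rw [Finset.sum_sub_distrib, hM] at h1
    have h2 : (0 : ℤ) < ((j : ℕ) - (i : ℕ)) * (d j - d i) :=
      mul_pos (by have : (i : ℕ) < j := hij; omega) (by omega)
    omega

/-! ### Reading words of skew tableaux -/

/-- `p` precedes `q` when cells are read from right to left in successive rows. -/
abbrev ReadBefore (p q : ℕ × ℕ) : Prop :=
  p.1 < q.1 ∨ p.1 = q.1 ∧ q.2 < p.2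

/-- The cells of `S` in reading order. -/
def readingCells (S : Finset (ℕ × ℕ)) : List (ℕ × ℕ) :=
  (List.range (S.sup Prod.fst + 1)).flatMap fun i =>
    ((List.range (S.sup Prod.snd + 1)).reverse.filter fun j => (i, j) ∈ S).map (Prod.mk i)

theorem fillingWord_eq_map (S : Finset (ℕ × ℕ)) (f : ℕ → ℕ → ℕ) :
    fillingWord S f = (readingCells S).map fun p => f p.1 p.2 := by
  simp only [fillingWord, readingCells, List.map_flatMap, List.map_map]
  rfl

theorem mem_readingCells {S : Finset (ℕ × ℕ)} {p : ℕ × ℕ} : p ∈ readingCells S ↔ p ∈ S := by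
  simp only [readingCells, List.mem_flatMap, List.mem_range, List.mem_map, List.mem_filter,
    List.mem_reverse, decide_eq_true_eq]
  constructor
  · rintro ⟨i, _, j, ⟨_, h⟩, rfl⟩; exact h
  · intro h
    exact ⟨p.1, Nat.lt_succ_of_le (Finset.le_sup (f := Prod.fst) h), p.2,
      ⟨Nat.lt_succ_of_le (Finset.le_sup (f := Prod.snd) h), h⟩, rfl⟩

theorem pairwise_readingCells (S : Finset (ℕ × ℕ)) : (readingCells S).Pairwise ReadBefore := by
  rw [readingCells, List.pairwise_flatMap]
  constructor
  · intro i _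
    rw [List.pairwise_map]
    refine List.Pairwise.filter _ ?_
    rw [List.pairwise_reverse]
    exact List.pairwise_lt_range.imp fun h => Or.inr ⟨rfl, h⟩
  · refine List.pairwise_lt_range.imp fun h p hp q hq => ?_
    simp only [List.mem_map] at hp hq
    obtain ⟨_, _, rfl⟩ := hp
    obtain ⟨_, _, rfl⟩ := hq
    exact Or.inl h

theorem nodup_readingCells (S : Finset (ℕ × ℕ)) : (readingCells S).Nodup :=
  (pairwise_readingCells S).imp fun {p q} h => by rintro rfl; omega

theorem toFinset_readingCells (S : Finset (ℕ × ℕ)) : (readingCells S).toFinset = S := by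
  ext p; simp [mem_readingCells]

theorem count_fillingWord (S : Finset (ℕ × ℕ)) (f : ℕ → ℕ → ℕ) (k : ℕ) :
    (fillingWord S f).count k = fillingWeight S f k := by
  rw [fillingWord_eq_map, List.count_eq_countP, List.countP_map, List.countP_eq_length_filter,
    ← List.toFinset_card_of_nodup ((nodup_readingCells S).filter _), List.toFinset_filter,
    toFinset_readingCells, fillingWeight]
  congr 1
  ext p
  simp

theorem excess_map_eq_sum {l : List (ℕ × ℕ)} (hl : l.Nodup) (g : ℕ × ℕ → ℕ) (k : ℕ) :
    excess k (l.map g) = ∑ p ∈ l.toFinset, letterSign k (g p) := by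
  induction l with
  | nil => simp
  | cons a l ih =>
    rw [List.nodup_cons] at hl
    rw [List.toFinset_cons, Finset.sum_insert (by simpa using hl.1), ← ih hl.2, List.map_cons]
    simp only [excess, List.count_cons, letterSign, beq_iff_eq]
    push_cast
    ring

theorem mem_take_readingCells {S : Finset (ℕ × ℕ)} {m : ℕ} {x : ℕ × ℕ}
    (hx : (readingCells S)[m]? = some x) (p : ℕ × ℕ) :
    p ∈ (readingCells S).take m ↔ p ∈ S ∧ ReadBefore p x := by
  obtain ⟨hm, rfl⟩ := List.getElem?_eq_some_iff.1 hx
  have hp := pairwise_readingCells S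
  have hsplit : p ∈ S ↔ p ∈ (readingCells S).take m ∨ p = (readingCells S)[m] ∨
      p ∈ (readingCells S).drop (m + 1) := by
    rw [← mem_readingCells, ← List.mem_cons, ← List.drop_eq_getElem_cons hm, ← List.mem_append,
      List.take_append_drop]
  rw [← List.take_append_drop m (readingCells S), List.drop_eq_getElem_cons hm,
    List.pairwise_append, List.pairwise_cons] at hp
  rw [hsplit]
  constructor
  · exact fun h => ⟨Or.inl h, hp.2.2 p h _ List.mem_cons_self⟩
  · rintro ⟨h | rfl | h, hlt⟩
    · exact h
    · omega
    · have := hp.2.1.1 p h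
      omega

theorem excess_take_fillingWord {S : Finset (ℕ × ℕ)} (f : ℕ → ℕ → ℕ) {m : ℕ} {x : ℕ × ℕ}
    (hx : (readingCells S)[m]? = some x) (k : ℕ) :
    excess k ((fillingWord S f).take m) =
      ∑ p ∈ S with ReadBefore p x, letterSign k (f p.1 p.2) := by
  rw [fillingWord_eq_map, ← List.map_take,
    excess_map_eq_sum ((nodup_readingCells S).sublist (List.take_sublist _ _))]
  congr 1
  ext p
  rw [List.mem_toFinset, mem_take_readingCells hx, Finset.mem_filter]

theorem excess_take_succ_fillingWord {S : Finset (ℕ × ℕ)} (f : ℕ → ℕ → ℕ) {m : ℕ} {x : ℕ × ℕ}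
    (hx : (readingCells S)[m]? = some x) (k : ℕ) :
    excess k ((fillingWord S f).take (m + 1)) =
      ∑ p ∈ S with ReadBefore p x ∨ p = x, letterSign k (f p.1 p.2) := by
  rw [fillingWord_eq_map, ← List.map_take,
    excess_map_eq_sum ((nodup_readingCells S).sublist (List.take_sublist _ _))]
  congr 1
  ext p
  have hxS : x ∈ S := mem_readingCells.1 (List.mem_of_getElem? hx)
  rw [List.mem_toFinset, List.take_add_one, hx, List.mem_append, mem_take_readingCells hx,
    Finset.mem_filter]
  simp only [Option.toList_some, List.mem_singleton]
  constructor
  · rintro (⟨h, h'⟩ | rfl)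
    · exact ⟨h, Or.inl h'⟩
    · exact ⟨hxS, Or.inr rfl⟩
  · rintro ⟨h, h' | h'⟩
    · exact Or.inl ⟨h, h'⟩
    · exact Or.inr h'

/-- The excess of the subword read from the cell `y` to the cell `x`, both included. -/
def segmentExcess (S : Finset (ℕ × ℕ)) (f : ℕ → ℕ → ℕ) (k : ℕ) (y x : ℕ × ℕ) : ℤ :=
  ∑ p ∈ S with ¬ ReadBefore p y ∧ (ReadBefore p x ∨ p = x), letterSign k (f p.1 p.2)

theorem segmentExcess_eq_card_sub_card (S : Finset (ℕ × ℕ)) (f : ℕ → ℕ → ℕ) (k : ℕ)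
    (y x : ℕ × ℕ) :
    segmentExcess S f k y x =
      (S.filter fun p => (¬ ReadBefore p y ∧ (ReadBefore p x ∨ p = x)) ∧ f p.1 p.2 = k).card -
      (S.filter fun p =>
        (¬ ReadBefore p y ∧ (ReadBefore p x ∨ p = x)) ∧ f p.1 p.2 = k + 1).card := by
  simp only [segmentExcess, letterSign, Finset.sum_sub_distrib, Finset.sum_boole,
    Finset.filter_filter]

theorem excess_take_add_segmentExcess {S : Finset (ℕ × ℕ)} (f : ℕ → ℕ → ℕ) (k : ℕ) {m m' : ℕ}
    {x y : ℕ × ℕ} (hy : (readingCells S)[m]? = some y) (hx : (readingCells S)[m']? = some x)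
    (hyx : ReadBefore y x ∨ y = x) :
    excess k ((fillingWord S f).take m) + segmentExcess S f k y x =
      excess k ((fillingWord S f).take (m' + 1)) := by
  rw [excess_take_fillingWord f hy, excess_take_succ_fillingWord f hx, segmentExcess,
    ← Finset.sum_filter_add_sum_filter_not (S.filter fun p => ReadBefore p x ∨ p = x)
      (fun p => ReadBefore p y), Finset.filter_filter, Finset.filter_filter]
  congr 1
  · refine Finset.sum_congr (Finset.filter_congr fun p _ => ?_) fun _ _ => rfl
    constructor
    · intro h
      refine ⟨Or.inl ?_, h⟩
      rcases hyx with h' | rfl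
      · omega
      · exact h
    · exact fun h => h.2
  · exact Finset.sum_congr (Finset.filter_congr fun p _ => and_comm) fun _ _ => rfl

theorem lt_of_readBefore {S : Finset (ℕ × ℕ)} {m m' : ℕ} {x y : ℕ × ℕ}
    (hy : (readingCells S)[m]? = some y) (hx : (readingCells S)[m']? = some x)
    (hyx : ReadBefore y x) : m < m' := by
  obtain ⟨hm, rfl⟩ := List.getElem?_eq_some_iff.1 hy
  obtain ⟨hm', rfl⟩ := List.getElem?_eq_some_iff.1 hx
  by_contra hle
  rcases lt_or_eq_of_le (not_lt.1 hle) with h | rfl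
  · have := List.pairwise_iff_getElem.1 (pairwise_readingCells S) _ _ hm' hm h
    omega
  · omega

/-- Semistandard fillings of a set `S` of cells, normalized to vanish outside `S`. -/
structure IsSemistandardFilling (S : Finset (ℕ × ℕ)) (f : ℕ → ℕ → ℕ) : Prop where
  row_weak : ∀ {i j j'}, (i, j) ∈ S → (i, j') ∈ S → j < j' → f i j ≤ f i j'
  col_strict : ∀ {i i' j}, (i, j) ∈ S → (i', j) ∈ S → i < i' → f i j < f i' j
  zeros : ∀ {i j}, (i, j) ∉ S → f i j = 0

/-- The filling `f` with the entry of the cell `x` replaced by `a`. -/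
def replaceEntry (f : ℕ → ℕ → ℕ) (x : ℕ × ℕ) (a : ℕ) (i j : ℕ) : ℕ :=
  if (i, j) = x then a else f i j

theorem fillingWord_replaceEntry {S : Finset (ℕ × ℕ)} (f : ℕ → ℕ → ℕ) {m : ℕ} {x : ℕ × ℕ}
    (hx : (readingCells S)[m]? = some x) (a : ℕ) :
    fillingWord S (replaceEntry f x a) = (fillingWord S f).set m a := by
  obtain ⟨hm, rfl⟩ := List.getElem?_eq_some_iff.1 hx
  rw [fillingWord_eq_map, fillingWord_eq_map]
  refine List.ext_getElem (by simp) fun i hi hi' => ?_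
  rw [List.getElem_map, List.getElem_set]
  simp only [replaceEntry, Prod.mk.eta, (nodup_readingCells S).getElem_inj_iff,
    List.getElem_map, eq_comm (a := m)]

theorem IsSemistandardFilling.replaceEntry {S : Finset (ℕ × ℕ)} {f : ℕ → ℕ → ℕ}
    (hf : IsSemistandardFilling S f) {i j a : ℕ} (hx : (i, j) ∈ S)
    (hleft : ∀ j', (i, j') ∈ S → j' < j → f i j' ≤ a)
    (hright : ∀ j', (i, j') ∈ S → j < j' → a ≤ f i j')
    (habove : ∀ i', (i', j) ∈ S → i' < i → f i' j < a)
    (hbelow : ∀ i', (i', j) ∈ S → i < i' → a < f i' j) :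
    IsSemistandardFilling S (replaceEntry f (i, j) a) := by
  refine ⟨fun {i₁ j₁ j₂} h₁ h₂ hlt => ?_, fun {i₁ i₂ j₁} h₁ h₂ hlt => ?_, fun {i₁ j₁} h => ?_⟩
  · simp only [_root_.replaceEntry, Prod.mk.injEq]
    split_ifs with h h' h'
    · exact le_rfl
    · obtain ⟨rfl, rfl⟩ := h; exact hright _ h₂ hlt
    · obtain ⟨rfl, rfl⟩ := h'; exact hleft _ h₁ hlt
    · exact hf.row_weak h₁ h₂ hlt
  · simp only [_root_.replaceEntry, Prod.mk.injEq]
    split_ifs with h h' h'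
    · omega
    · obtain ⟨rfl, rfl⟩ := h; exact hbelow _ h₂ hlt
    · obtain ⟨rfl, rfl⟩ := h'; exact habove _ h₁ hlt
    · exact hf.col_strict h₁ h₂ hlt
  · rw [_root_.replaceEntry, if_neg (fun e => h (by rw [e]; exact hx))]
    exact hf.zeros h

theorem IsSemistandardFilling.row_le {S : Finset (ℕ × ℕ)} {f : ℕ → ℕ → ℕ}
    (hf : IsSemistandardFilling S f) {i j j' : ℕ} (h : (i, j) ∈ S) (h' : (i, j') ∈ S)
    (hle : j ≤ j') : f i j ≤ f i j' := by
  rcases hle.eq_or_lt with rfl | hlt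
  · exact le_rfl
  · exact hf.row_weak h h' hlt

section OrdConnected

variable {S : Finset (ℕ × ℕ)} {f : ℕ → ℕ → ℕ} {k : ℕ}

theorem mem_of_ordConnected (hS : (S : Set (ℕ × ℕ)).OrdConnected) {a b i j c d : ℕ}
    (h : (a, b) ∈ S) (h' : (c, d) ∈ S) (h₁ : a ≤ i) (h₂ : b ≤ j) (h₃ : i ≤ c) (h₄ : j ≤ d) :
    (i, j) ∈ S :=
  hS.out (x := (a, b)) (by exact_mod_cast h) (y := (c, d)) (by exact_mod_cast h')
    ⟨⟨h₁, h₂⟩, ⟨h₃, h₄⟩⟩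

/-- If two cells of a row have the same entry, the filling is constant between them. With `s = 1`
for the entry `k` and `s = -1` for `k + 1`, this bounds the excess of the subword read there. -/
theorem two_le_mul_segmentExcess (hf : IsSemistandardFilling S f) {i j j' : ℕ} {s : ℤ}
    (h : (i, j) ∈ S) (h' : (i, j') ∈ S) (hlt : j < j') (he : f i j = f i j')
    (hs : s * letterSign k (f i j) = 1) : 2 ≤ s * segmentExcess S f k (i, j') (i, j) := by
  rw [segmentExcess, Finset.mul_sum]
  have hterm : ∀ p ∈ S.filter fun p =>
      ¬ ReadBefore p (i, j') ∧ (ReadBefore p (i, j) ∨ p = (i, j)),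
      s * letterSign k (f p.1 p.2) = 1 := by
    rintro ⟨a, b⟩ hp
    simp only [Finset.mem_filter, Prod.mk.injEq] at hp
    obtain ⟨hp, h₁, h₂⟩ := hp
    obtain rfl : a = i := by omega
    have h₃ := hf.row_le h hp (by omega)
    have h₄ := hf.row_le hp h' (by omega)
    rw [show f a b = f a j by omega, hs]
  rw [Finset.sum_congr rfl hterm, Finset.sum_const, nsmul_eq_mul, mul_one]
  have hsub : ({(i, j), (i, j')} : Finset (ℕ × ℕ)) ⊆ S.filter fun p =>
      ¬ ReadBefore p (i, j') ∧ (ReadBefore p (i, j) ∨ p = (i, j)) := by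
    intro p hp
    simp only [Finset.mem_insert, Finset.mem_singleton] at hp
    rcases hp with rfl | rfl
    · simp only [Finset.mem_filter]; exact ⟨h, by omega, Or.inr trivial⟩
    · simp only [Finset.mem_filter]; exact ⟨h', by omega, Or.inl (Or.inr ⟨rfl, hlt⟩)⟩
  have := Finset.card_le_card hsub
  rw [Finset.card_pair (by simp; omega)] at this
  exact_mod_cast this

/-- If `k + 1` stands below `k` in adjacent rows, some segment that ends at `k + 1` has nonnegative
excess: every letter `k + 1` read in it has the letter `k` above it. -/
theorem exists_segmentExcess_nonneg (hS : (S : Set (ℕ × ℕ)).OrdConnected)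
    (hf : IsSemistandardFilling S f) {i j : ℕ} (h : (i, j) ∈ S) (h' : (i + 1, j) ∈ S)
    (hk : f i j = k) (hk' : f (i + 1) j = k + 1) :
    ∃ y ∈ S, ReadBefore y (i + 1, j) ∧ 0 ≤ segmentExcess S f k y (i + 1, j) := by
  obtain ⟨⟨a, J⟩, hJ, hmax⟩ := Finset.exists_max_image
    (S.filter fun p => p.1 = i + 1 ∧ f p.1 p.2 = k + 1) Prod.snd
    ⟨(i + 1, j), by simp [h', hk']⟩
  simp only [Finset.mem_filter] at hJ
  obtain ⟨hJS, rfl, hJk⟩ := hJ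
  have hjJ : j ≤ J := hmax (i + 1, j) (by simp [h', hk'])
  refine ⟨(i, J), mem_of_ordConnected hS h hJS le_rfl hjJ (by omega) le_rfl,
    Or.inl (Nat.lt_succ_self i), ?_⟩
  rw [segmentExcess_eq_card_sub_card, sub_nonneg, Nat.cast_le]
  have key : ∀ a b, (a, b) ∈ S → ¬ ReadBefore (a, b) (i, J) →
      (ReadBefore (a, b) (i + 1, j) ∨ (a, b) = (i + 1, j)) → f a b = k + 1 →
      a = i + 1 ∧ j ≤ b ∧ b ≤ J := by
    intro a b hp h₁ h₂ hv
    simp only [Prod.mk.injEq] at h₁ h₂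
    have ha : a ≠ i := by
      rintro rfl
      rcases le_or_gt j b with hjb | hjb
      · have h₃ : (a + 1, b) ∈ S := mem_of_ordConnected hS h' hJS le_rfl hjb le_rfl (by omega)
        have h₄ := hf.row_le h₃ hJS (by omega)
        have h₅ := hf.col_strict hp h₃ (Nat.lt_succ_self a)
        omega
      · have := hf.row_weak hp h hjb
        omega
    obtain rfl : a = i + 1 := by omega
    exact ⟨rfl, by omega, hmax (i + 1, b) (by simp [hp, hv])⟩
  refine Finset.card_le_card_of_injOn (fun p => (i, p.2)) ?_ ?_
  · rintro ⟨a, b⟩ hp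
    simp only [Finset.coe_filter, Set.mem_ofPred_eq] at hp
    obtain ⟨hp, ⟨h₁, h₂⟩, hv⟩ := hp
    obtain ⟨rfl, hjb, hbJ⟩ := key a b hp h₁ h₂ hv
    have h₃ : (i, b) ∈ S := mem_of_ordConnected hS h hp le_rfl hjb (by omega) le_rfl
    have h₄ := hf.row_le h h₃ hjb
    have h₅ := hf.col_strict h₃ hp (Nat.lt_succ_self i)
    simp only [Finset.coe_filter, Set.mem_ofPred_eq]
    exact ⟨h₃, ⟨by omega, Or.inl (Or.inl (Nat.lt_succ_self i))⟩, by omega⟩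
  · rintro ⟨a, b⟩ hp ⟨a', b'⟩ hp' e
    simp only [Finset.coe_filter, Set.mem_ofPred_eq] at hp hp'
    obtain ⟨rfl, -⟩ := key a b hp.1 hp.2.1.1 hp.2.1.2 hp.2.2
    obtain ⟨rfl, -⟩ := key a' b' hp'.1 hp'.2.1.1 hp'.2.1.2 hp'.2.2
    simpa using e

/-- If `k + 1` stands below `k` in adjacent rows, some segment that starts at `k` has nonpositive
excess: every letter `k` read in it has the letter `k + 1` below it. -/
theorem exists_segmentExcess_nonpos (hS : (S : Set (ℕ × ℕ)).OrdConnected)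
    (hf : IsSemistandardFilling S f) {i j : ℕ} (h : (i, j) ∈ S) (h' : (i + 1, j) ∈ S)
    (hk : f i j = k) (hk' : f (i + 1) j = k + 1) :
    ∃ y ∈ S, ReadBefore (i, j) y ∧ segmentExcess S f k (i, j) y ≤ 0 := by
  obtain ⟨⟨a, J⟩, hJ, hmin⟩ := Finset.exists_min_image
    (S.filter fun p => p.1 = i ∧ f p.1 p.2 = k) Prod.snd ⟨(i, j), by simp [h, hk]⟩
  simp only [Finset.mem_filter] at hJ
  obtain ⟨hJS, rfl, hJk⟩ := hJ
  have hJj : J ≤ j := hmin (a, j) (by simp [h, hk])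
  refine ⟨(a + 1, J), mem_of_ordConnected hS hJS h' (by omega) le_rfl le_rfl hJj,
    Or.inl (Nat.lt_succ_self a), ?_⟩
  rw [segmentExcess_eq_card_sub_card, sub_nonpos, Nat.cast_le]
  have key : ∀ c b, (c, b) ∈ S → ¬ ReadBefore (c, b) (a, j) →
      (ReadBefore (c, b) (a + 1, J) ∨ (c, b) = (a + 1, J)) → f c b = k →
      c = a ∧ b ≤ j ∧ J ≤ b := by
    intro c b hp h₁ h₂ hv
    simp only [Prod.mk.injEq] at h₁ h₂
    have hc : c ≠ a + 1 := by
      rintro rfl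
      rcases le_or_gt b j with hbj | hbj
      · have h₃ : (a, b) ∈ S := mem_of_ordConnected hS hJS h le_rfl (by omega) le_rfl hbj
        have h₄ := hf.row_le hJS h₃ (by omega)
        have h₅ := hf.col_strict h₃ hp (Nat.lt_succ_self a)
        omega
      · have := hf.row_weak h' hp hbj
        omega
    obtain rfl : c = a := by omega
    exact ⟨rfl, by omega, hmin (c, b) (by simp [hp, hv])⟩
  refine Finset.card_le_card_of_injOn (fun p => (a + 1, p.2)) ?_ ?_
  · rintro ⟨c, b⟩ hp
    simp only [Finset.coe_filter, Set.mem_ofPred_eq] at hp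
    obtain ⟨hp, ⟨h₁, h₂⟩, hv⟩ := hp
    obtain ⟨rfl, hbj, hJb⟩ := key c b hp h₁ h₂ hv
    have h₃ : (c + 1, b) ∈ S := mem_of_ordConnected hS hp h' (by omega) le_rfl le_rfl hbj
    have h₄ := hf.row_le h₃ h' hbj
    have h₅ := hf.col_strict hp h₃ (Nat.lt_succ_self c)
    simp only [Finset.coe_filter, Set.mem_ofPred_eq]
    refine ⟨h₃, ⟨by omega, ?_⟩, by omega⟩
    rcases hJb.eq_or_lt with rfl | hlt
    · exact Or.inr rfl
    · exact Or.inl (Or.inr ⟨rfl, hlt⟩)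
  · rintro ⟨c, b⟩ hp ⟨c', b'⟩ hp' e
    simp only [Finset.coe_filter, Set.mem_ofPred_eq] at hp hp'
    obtain ⟨rfl, -⟩ := key c b hp.1 hp.2.1.1 hp.2.1.2 hp.2.2
    obtain ⟨rfl, -⟩ := key c' b' hp'.1 hp'.2.1.1 hp'.2.1.2 hp'.2.2
    simpa using e

/-- Between vertically adjacent letters `k` and `k + 1` there is no further row. -/
theorem IsSemistandardFilling.succ_eq_of_col (hS : (S : Set (ℕ × ℕ)).OrdConnected)
    (hf : IsSemistandardFilling S f) {i i' j : ℕ} (h : (i, j) ∈ S) (h' : (i', j) ∈ S)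
    (hlt : i < i') (hk : f i j = k) (hk' : f i' j = k + 1) : i' = i + 1 := by
  by_contra hne
  have h₁ : (i + 1, j) ∈ S := mem_of_ordConnected hS h h' (by omega) le_rfl (by omega) le_rfl
  have h₂ := hf.col_strict h h₁ (Nat.lt_succ_self i)
  have h₃ := hf.col_strict h₁ h' (by omega)
  omega

theorem exists_cell_of_getElem? {m a : ℕ} (h : (fillingWord S f)[m]? = some a) :
    ∃ i j, (readingCells S)[m]? = some (i, j) ∧ (i, j) ∈ S ∧ f i j = a := by
  rw [fillingWord_eq_map, List.getElem?_map, Option.map_eq_some_iff] at h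
  obtain ⟨⟨i, j⟩, hx, h⟩ := h
  exact ⟨i, j, hx, mem_readingCells.1 (List.mem_of_getElem? hx), h⟩

theorem exists_index {x : ℕ × ℕ} (h : x ∈ S) : ∃ m : ℕ, (readingCells S)[m]? = some x :=
  List.mem_iff_getElem?.1 (mem_readingCells.2 h)

/-- The reading words of the semistandard fillings of a skew diagram form a crystal. -/
theorem isCrystal_fillingWord (hS : (S : Set (ℕ × ℕ)).OrdConnected) :
    IsCrystal (fillingWord S '' {f | IsSemistandardFilling S f}) := by
  constructor
  · rintro _ k m ⟨f, hf, rfl⟩ hm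
    change IsSemistandardFilling S f at hf
    obtain ⟨i, j, hx, hxS, hk⟩ := exists_cell_of_getElem? hm.1
    have hsucc := excess_take_succ (k := k) hm.1
    rw [letterSign_self] at hsucc
    have hbefore : ∀ y ∈ S, ReadBefore y (i, j) → segmentExcess S f k y (i, j) ≤ 1 := by
      intro y hy hlt
      obtain ⟨n, hn⟩ := exists_index hy
      have h1 := excess_take_add_segmentExcess f k hn hx (Or.inl hlt)
      have h2 := hm.2.1 n (lt_of_readBefore hn hx hlt).le
      omega
    have hafter : ∀ y ∈ S, ReadBefore (i, j) y → 0 < segmentExcess S f k (i, j) y := by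
      intro y hy hlt
      obtain ⟨n, hn⟩ := exists_index hy
      have h1 := excess_take_add_segmentExcess f k hx hn (Or.inl hlt)
      have h2 := hm.2.2 (n + 1) (Nat.lt_succ_of_lt (lt_of_readBefore hx hn hlt))
      omega
    refine ⟨replaceEntry f (i, j) (k + 1), hf.replaceEntry hxS ?_ ?_ ?_ ?_,
      fillingWord_replaceEntry f hx _⟩
    · intro j' h hlt
      have := hf.row_weak h hxS hlt
      omega
    · intro j' h hlt
      have h1 := hf.row_weak hxS h hlt
      by_contra hne
      have h2 := two_le_mul_segmentExcess (k := k) (s := 1) hf hxS h hlt (by omega)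
        (by rw [hk, letterSign_self, one_mul])
      have h3 := hbefore _ h (Or.inr ⟨rfl, hlt⟩)
      omega
    · intro i' h hlt
      have := hf.col_strict h hxS hlt
      omega
    · intro i' h hlt
      have h1 := hf.col_strict hxS h hlt
      by_contra hne
      have hk' : f i' j = k + 1 := by omega
      obtain rfl := hf.succ_eq_of_col hS hxS h hlt hk hk'
      obtain ⟨y, hy, hlt', hle⟩ := exists_segmentExcess_nonpos hS hf hxS h hk hk'
      have := hafter y hy hlt'
      omega
  · rintro _ k m ⟨f, hf, rfl⟩ hm
    change IsSemistandardFilling S f at hf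
    obtain ⟨i, j, hx, hxS, hk⟩ := exists_cell_of_getElem? hm.1
    have hsucc := excess_take_succ (k := k) hm.1
    rw [letterSign_succ] at hsucc
    have hbefore : ∀ y ∈ S, ReadBefore y (i, j) → segmentExcess S f k y (i, j) < 0 := by
      intro y hy hlt
      obtain ⟨n, hn⟩ := exists_index hy
      have h1 := excess_take_add_segmentExcess f k hn hx (Or.inl hlt)
      have h2 := hm.2.1 n (lt_of_readBefore hn hx hlt).le
      omega
    have hafter : ∀ y ∈ S, ReadBefore (i, j) y → -1 ≤ segmentExcess S f k (i, j) y := by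
      intro y hy hlt
      obtain ⟨n, hn⟩ := exists_index hy
      have h1 := excess_take_add_segmentExcess f k hx hn (Or.inl hlt)
      have h2 := hm.2.2 (n + 1) (Nat.lt_succ_of_lt (lt_of_readBefore hx hn hlt))
      omega
    refine ⟨replaceEntry f (i, j) k, hf.replaceEntry hxS ?_ ?_ ?_ ?_,
      fillingWord_replaceEntry f hx _⟩
    · intro j' h hlt
      have h1 := hf.row_weak h hxS hlt
      by_contra hne
      have h2 := two_le_mul_segmentExcess (k := k) (s := -1) hf h hxS hlt (by omega)
        (by rw [show f i j' = k + 1 by omega, letterSign_succ]; rfl)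
      have h3 := hafter _ h (Or.inr ⟨rfl, hlt⟩)
      omega
    · intro j' h hlt
      have := hf.row_weak hxS h hlt
      omega
    · intro i' h hlt
      have h1 := hf.col_strict h hxS hlt
      by_contra hne
      have hk' : f i' j = k := by omega
      obtain rfl := hf.succ_eq_of_col hS h hxS hlt hk' hk
      obtain ⟨y, hy, hlt', hle⟩ := exists_segmentExcess_nonneg hS hf h hxS hk' hk
      have := hbefore y hy hlt'
      omega
    · intro i' h hlt
      have := hf.col_strict hxS h hlt
      omega

end OrdConnected

theorem fillingWord_injOn (S : Finset (ℕ × ℕ)) :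
    Set.InjOn (fillingWord S) {f | IsSemistandardFilling S f} := by
  intro f hf g hg h
  rw [fillingWord_eq_map, fillingWord_eq_map, List.map_inj_left] at h
  funext i j
  by_cases hij : (i, j) ∈ S
  · exact h (i, j) (mem_readingCells.2 hij)
  · rw [hf.zeros hij, hg.zeros hij]

/-! ### Highest weight fillings of straight shapes -/

theorem YoungDiagram.ordConnected_cells (μ : YoungDiagram) :
    (μ.cells : Set (ℕ × ℕ)).OrdConnected :=
  μ.isLowerSet.ordConnected

theorem YoungDiagram.ext_rowLen {μ ν : YoungDiagram} (h : ∀ i, μ.rowLen i = ν.rowLen i) :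
    μ = ν := by
  ext ⟨i, j⟩
  rw [YoungDiagram.mem_cells, YoungDiagram.mem_cells, YoungDiagram.mem_iff_lt_rowLen,
    YoungDiagram.mem_iff_lt_rowLen, h]

/-- The reading words of the semistandard tableaux of shape `μ`. -/
def tableauWords (μ : YoungDiagram) : Set (List ℕ) :=
  fillingWord μ.cells '' {f | IsSemistandardFilling μ.cells f}

theorem isCrystal_tableauWords (μ : YoungDiagram) : IsCrystal (tableauWords μ) :=
  isCrystal_fillingWord μ.ordConnected_cells

theorem SemistandardYoungTableau.isSemistandardFilling {μ : YoungDiagram}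
    (T : SemistandardYoungTableau μ) : IsSemistandardFilling μ.cells T :=
  ⟨fun _ h hlt => T.row_weak hlt h, fun _ h hlt => T.col_strict hlt h, fun h => T.zeros h⟩

theorem IsSemistandardFilling.eq_row_of_isLatticePermutation {μ : YoungDiagram} {f : ℕ → ℕ → ℕ}
    (hf : IsSemistandardFilling μ.cells f)
    (hl : IsLatticePermutation (fillingWord μ.cells f)) (i : ℕ) :
    ∀ j, (i, j) ∈ μ → f i j = i := by
  induction i using Nat.strong_induction_on with
  | _ i ih =>
  intro j hj
  have hpos : j < μ.rowLen i := YoungDiagram.mem_iff_lt_rowLen.1 hj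
  have hlast : (i, μ.rowLen i - 1) ∈ μ := YoungDiagram.mem_iff_lt_rowLen.2 (by omega)
  have hle : f i (μ.rowLen i - 1) ≤ i := by
    by_contra hgt
    obtain ⟨k, hk⟩ : ∃ k, f i (μ.rowLen i - 1) = k + 1 :=
      Nat.exists_eq_succ_of_ne_zero (by omega)
    obtain ⟨m, hm⟩ := exists_index (S := μ.cells) hlast
    have h0 := isLatticePermutation_iff.1 hl (m + 1) k
    -- all cells read earlier lie in higher rows, so their entries are smaller than `k`
    rw [excess_take_succ_fillingWord f hm, Finset.sum_eq_single (i, μ.rowLen i - 1)] at h0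
    · simp only [hk, letterSign_succ] at h0
      omega
    · rintro ⟨a, b⟩ hp hne
      simp only [Finset.mem_filter, YoungDiagram.mem_cells] at hp
      have hb : b < μ.rowLen a := YoungDiagram.mem_iff_lt_rowLen.1 hp.1
      rcases hp.2 with (h | ⟨rfl, h⟩) | h
      · have := ih a h b hp.1
        exact letterSign_of_ne (by simp only at h; simp only; omega)
          (by simp only at h; simp only; omega)
      · simp only at h; omega
      · exact absurd h hne
    · intro h
      exact absurd (by simp [hlast]) h
  have hle' := hf.row_le (i := i) (j := j) hj hlast (by omega)
  refine le_antisymm (hle'.trans hle) ?_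
  cases i with
  | zero => exact Nat.zero_le _
  | succ i =>
    have hup : (i, j) ∈ μ := μ.up_left_mem (Nat.le_succ i) le_rfl hj
    have h1 := hf.col_strict (i := i) hup hj (Nat.lt_succ_self i)
    rw [ih i (Nat.lt_succ_self i) j hup] at h1
    exact h1

theorem isLatticePermutation_of_eq_row {μ : YoungDiagram} {f : ℕ → ℕ → ℕ}
    (hf : ∀ i j, (i, j) ∈ μ → f i j = i) : IsLatticePermutation (fillingWord μ.cells f) := by
  rw [isLatticePermutation_iff]
  suffices h : ∀ m < (readingCells μ.cells).length, ∀ k,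
      0 ≤ excess k ((fillingWord μ.cells f).take (m + 1)) by
    intro m k
    have hlen : (fillingWord μ.cells f).length = (readingCells μ.cells).length := by
      rw [fillingWord_eq_map, List.length_map]
    have e : (fillingWord μ.cells f).take m =
        (fillingWord μ.cells f).take (min m (fillingWord μ.cells f).length) := by
      rcases le_total m (fillingWord μ.cells f).length with h' | h'
      · rw [min_eq_left h']
      · rw [min_eq_right h', List.take_of_length_le h', List.take_length]
    rw [e]
    rcases Nat.eq_zero_or_eq_succ_pred (min m (fillingWord μ.cells f).length) with h' | h'
    · rw [h']; simp
    · rw [h']; exact h _ (by omega) k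
  intro m hm k
  obtain ⟨⟨i, j⟩, hx⟩ : ∃ x, (readingCells μ.cells)[m]? = some x :=
    ⟨_, List.getElem?_eq_getElem hm⟩
  rw [excess_take_succ_fillingWord f hx]
  simp only [letterSign, Finset.sum_sub_distrib, Finset.sum_boole, Finset.filter_filter]
  rw [sub_nonneg, Nat.cast_le]
  refine Finset.card_le_card_of_injOn (fun p => (k, p.2)) ?_ ?_
  · rintro ⟨a, b⟩ hp
    simp only [Finset.coe_filter, Set.mem_ofPred_eq, YoungDiagram.mem_cells] at hp ⊢
    obtain ⟨hp, hle, hv⟩ := hp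
    obtain rfl : a = k + 1 := (hf a b hp).symm.trans hv
    have hup : (k, b) ∈ μ := μ.up_left_mem (Nat.le_succ k) le_rfl hp
    refine ⟨hup, Or.inl (Or.inl ?_), hf k b hup⟩
    simp only [Prod.mk.injEq] at hle ⊢
    omega
  · rintro ⟨a, b⟩ hp ⟨a', b'⟩ hp' e
    simp only [Finset.coe_filter, Set.mem_ofPred_eq, YoungDiagram.mem_cells] at hp hp'
    obtain rfl : a = k + 1 := (hf a b hp.1).symm.trans hp.2.2
    obtain rfl : a' = k + 1 := (hf a' b' hp'.1).symm.trans hp'.2.2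
    simpa using e

theorem fillingWeight_of_eq_row {μ : YoungDiagram} {f : ℕ → ℕ → ℕ}
    (hf : ∀ i j, (i, j) ∈ μ → f i j = i) (k : ℕ) :
    fillingWeight μ.cells f k = μ.rowLen k := by
  rw [YoungDiagram.rowLen_eq_card, fillingWeight, YoungDiagram.row]
  congr 1
  refine Finset.filter_congr fun p hp => ?_
  rw [hf p.1 p.2 hp]

/-- A straight shape has exactly one semistandard tableau whose word is a lattice permutation; all
entries of its `i`-th row are `i`. -/
theorem card_latticeWords_tableauWords (μ ν : YoungDiagram) [Decidable (μ = ν)] :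
    Nat.card (latticeWords (tableauWords μ) fun i => ν.rowLen i) = if μ = ν then 1 else 0 := by
  split_ifs with h
  · subst h
    rw [Nat.card_eq_one_iff_exists]
    have hT : ∀ i j, (i, j) ∈ μ → SemistandardYoungTableau.highestWeight μ i j = i :=
      fun i j h => by rw [SemistandardYoungTableau.highestWeight_apply, if_pos h]
    refine ⟨⟨fillingWord μ.cells (SemistandardYoungTableau.highestWeight μ),
      ⟨_, SemistandardYoungTableau.isSemistandardFilling _, rfl⟩, fun i => ?_,
      isLatticePermutation_of_eq_row hT⟩, ?_⟩
    · rw [count_fillingWord, fillingWeight_of_eq_row hT]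
    · rintro ⟨_, ⟨f, hf, rfl⟩, _, hl⟩
      refine Subtype.ext ?_
      simp only [fillingWord_eq_map, List.map_inj_left]
      rintro ⟨i, j⟩ hp
      rw [mem_readingCells, YoungDiagram.mem_cells] at hp
      rw [hT i j hp]
      exact IsSemistandardFilling.eq_row_of_isLatticePermutation hf hl i j hp
  · have : IsEmpty (latticeWords (tableauWords μ) fun i => (ν.rowLen i : ℤ)) := by
      refine ⟨?_⟩
      rintro ⟨_, ⟨f, hf, rfl⟩, hd, hl⟩
      refine h (YoungDiagram.ext_rowLen fun i => ?_)
      have := hd i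
      rw [count_fillingWord, fillingWeight_of_eq_row
        (IsSemistandardFilling.eq_row_of_isLatticePermutation hf hl)] at this
      exact Int.ofNat.inj this
    exact Nat.card_of_isEmpty

/-! ### Tuples of tableaux as fillings of a skew diagram -/

section Star

variable {r : ℕ} {lam : Fin r → YoungDiagram}

theorem starRow_add_le {i k : Fin r} (h : i < k) :
    starRow lam i + (lam i).colLen 0 ≤ starRow lam k := by
  have hi : i ∉ Finset.univ.filter (· < i) := by simp
  rw [starRow, starRow, add_comm, ← Finset.sum_insert (f := fun j => (lam j).colLen 0) hi]
  refine Finset.sum_le_sum_of_subset fun j hj => ?_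
  simp only [Finset.mem_insert, Finset.mem_filter, Finset.mem_univ, true_and] at hj ⊢
  rcases hj with rfl | hj
  · exact h
  · exact hj.trans h

theorem starCol_add_le {i k : Fin r} (h : i < k) :
    starCol lam k + (lam k).rowLen 0 ≤ starCol lam i := by
  have hi : k ∉ Finset.univ.filter (k < ·) := by simp
  rw [starCol, starCol, add_comm, ← Finset.sum_insert (f := fun j => (lam j).rowLen 0) hi]
  refine Finset.sum_le_sum_of_subset fun j hj => ?_
  simp only [Finset.mem_insert, Finset.mem_filter, Finset.mem_univ, true_and] at hj ⊢
  rcases hj with rfl | hj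
  · exact h
  · exact h.trans hj

theorem mem_starCells {a b : ℕ} : (a, b) ∈ starCells lam ↔
    ∃ i p q, (p, q) ∈ lam i ∧ a = p + starRow lam i ∧ b = q + starCol lam i := by
  simp only [starCells, Finset.mem_biUnion, Finset.mem_univ, true_and, Finset.mem_image,
    Prod.exists, Prod.mk.injEq, YoungDiagram.mem_cells]
  constructor
  · rintro ⟨i, p, q, h, rfl, rfl⟩; exact ⟨i, p, q, h, rfl, rfl⟩
  · rintro ⟨i, p, q, h, rfl, rfl⟩; exact ⟨i, p, q, h, rfl, rfl⟩

theorem lt_colLen_zero {μ : YoungDiagram} {p q : ℕ} (h : (p, q) ∈ μ) : p < μ.colLen 0 :=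
  YoungDiagram.mem_iff_lt_colLen.1 (μ.up_left_mem le_rfl (Nat.zero_le q) h)

theorem lt_rowLen_zero {μ : YoungDiagram} {p q : ℕ} (h : (p, q) ∈ μ) : q < μ.rowLen 0 :=
  YoungDiagram.mem_iff_lt_rowLen.1 (μ.up_left_mem (Nat.zero_le p) le_rfl h)

/-- A cell of one component of the skew diagram never lies weakly below and weakly to the right of
the corner of another component. In particular, comparable cells lie in the same component. -/
theorem star_index_eq {i k : Fin r} {p q : ℕ} (h : (p, q) ∈ lam k)
    (h₁ : starRow lam i ≤ p + starRow lam k) (h₂ : starCol lam i ≤ q + starCol lam k) :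
    i = k := by
  rcases lt_trichotomy i k with hlt | rfl | hlt
  · have := starCol_add_le (lam := lam) hlt
    have := lt_rowLen_zero h
    omega
  · rfl
  · have := starRow_add_le (lam := lam) hlt
    have := lt_colLen_zero h
    omega

theorem ordConnected_starCells (lam : Fin r → YoungDiagram) :
    (starCells lam : Set (ℕ × ℕ)).OrdConnected := by
  refine ⟨?_⟩
  rintro ⟨a, b⟩ hx ⟨a', b'⟩ hy ⟨c, d⟩ ⟨⟨h₁, h₂⟩, ⟨h₃, h₄⟩⟩
  simp only [Finset.mem_coe, mem_starCells] at hx hy ⊢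
  simp only at h₁ h₂ h₃ h₄
  obtain ⟨i, p, q, h, rfl, rfl⟩ := hx
  obtain ⟨k, p', q', h', rfl, rfl⟩ := hy
  obtain rfl := star_index_eq (i := i) h' (by omega) (by omega)
  exact ⟨i, c - starRow lam i, d - starCol lam i,
    (lam i).up_left_mem (by omega) (by omega) h', by omega, by omega⟩

/-- The filling of the skew diagram `λ^{(1)} * ⋯ * λ^{(r)}` obtained from tableaux on its
components, without any bound on the entries. -/
def starFillingOfTuple (T : (i : Fin r) → SemistandardYoungTableau (lam i)) (a b : ℕ) : ℕ :=
  ∑ i, if starRow lam i ≤ a ∧ starCol lam i ≤ b then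
    T i (a - starRow lam i) (b - starCol lam i) else 0

variable (T : (i : Fin r) → SemistandardYoungTableau (lam i))

theorem starFillingOfTuple_apply (i : Fin r) (p q : ℕ) :
    starFillingOfTuple T (p + starRow lam i) (q + starCol lam i) = T i p q := by
  rw [starFillingOfTuple, Finset.sum_eq_single i]
  · rw [if_pos ⟨by omega, by omega⟩, Nat.add_sub_cancel, Nat.add_sub_cancel]
  · intro k _ hne
    split_ifs with hk
    · refine (T k).zeros fun hmem => hne ?_
      exact (star_index_eq (i := i) hmem (by omega) (by omega)).symm
    · rfl
  · simp

theorem starFillingOfTuple_eq_zero {a b : ℕ} (h : (a, b) ∉ starCells lam) :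
    starFillingOfTuple T a b = 0 := by
  refine Finset.sum_eq_zero fun i _ => ?_
  split_ifs with hi
  · refine (T i).zeros fun hmem => h ?_
    exact mem_starCells.2 ⟨i, _, _, hmem, by omega, by omega⟩
  · rfl

theorem isSemistandardFilling_starFillingOfTuple :
    IsSemistandardFilling (starCells lam) (starFillingOfTuple T) := by
  refine ⟨fun {a b b'} h h' hlt => ?_, fun {a a' b} h h' hlt => ?_,
    fun h => starFillingOfTuple_eq_zero T h⟩
  · obtain ⟨i, p, q, hm, rfl, rfl⟩ := mem_starCells.1 h
    obtain ⟨k, p', q', hm', he, rfl⟩ := mem_starCells.1 h'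
    obtain rfl := star_index_eq (i := i) hm' (by omega) (by omega)
    obtain rfl : p = p' := by omega
    rw [starFillingOfTuple_apply, starFillingOfTuple_apply]
    exact (T i).row_weak (by omega) hm'
  · obtain ⟨i, p, q, hm, rfl, rfl⟩ := mem_starCells.1 h
    obtain ⟨k, p', q', hm', rfl, he⟩ := mem_starCells.1 h'
    obtain rfl := star_index_eq (i := i) hm' (by omega) (by omega)
    obtain rfl : q = q' := by omega
    rw [starFillingOfTuple_apply, starFillingOfTuple_apply]
    exact (T i).col_strict (by omega) hm'

theorem starFillingOfTuple_injective : Function.Injective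
    (starFillingOfTuple : ((i : Fin r) → SemistandardYoungTableau (lam i)) → ℕ → ℕ → ℕ) := by
  intro T T' h
  funext i
  refine SemistandardYoungTableau.ext fun p q => ?_
  rw [← starFillingOfTuple_apply T, ← starFillingOfTuple_apply T', h]

theorem exists_starFillingOfTuple_eq {f : ℕ → ℕ → ℕ}
    (hf : IsSemistandardFilling (starCells lam) f) :
    ∃ T : (i : Fin r) → SemistandardYoungTableau (lam i), starFillingOfTuple T = f := by
  have hmem : ∀ {i p q}, (p, q) ∈ lam i → (p + starRow lam i, q + starCol lam i) ∈ starCells lam :=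
    fun {i p q} h => mem_starCells.2 ⟨i, p, q, h, rfl, rfl⟩
  let T : (i : Fin r) → SemistandardYoungTableau (lam i) := fun i =>
    { entry := fun p q => if (p, q) ∈ lam i then f (p + starRow lam i) (q + starCol lam i) else 0
      row_weak' := fun {p q q'} hlt h => by
        have h' := (lam i).up_left_mem le_rfl hlt.le h
        simp only [if_pos h, if_pos h']
        exact hf.row_weak (hmem h') (hmem h) (by omega)
      col_strict' := fun {p p' q} hlt h => by
        have h' := (lam i).up_left_mem hlt.le le_rfl h
        simp only [if_pos h, if_pos h']
        exact hf.col_strict (hmem h') (hmem h) (by omega)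
      zeros' := fun {p q} h => if_neg h }
  refine ⟨T, ?_⟩
  funext a b
  by_cases hab : (a, b) ∈ starCells lam
  · obtain ⟨i, p, q, h, rfl, rfl⟩ := mem_starCells.1 hab
    rw [starFillingOfTuple_apply]
    exact if_pos h
  · rw [starFillingOfTuple_eq_zero T hab, hf.zeros hab]

theorem fillingWeight_starFillingOfTuple (k : ℕ) :
    fillingWeight (starCells lam) (starFillingOfTuple T) k =
      ∑ i, fillingWeight (lam i).cells (T i) k := by
  rw [fillingWeight, starCells, Finset.filter_biUnion, Finset.card_biUnion]
  · refine Finset.sum_congr rfl fun i _ => ?_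
    rw [fillingWeight, Finset.filter_image, Finset.card_image_of_injective]
    · congr 1
      refine Finset.filter_congr fun p hp => ?_
      rw [starFillingOfTuple_apply]
    · rintro ⟨p, q⟩ ⟨p', q'⟩ h
      simpa using h
  · intro i _ j _ hne
    rw [Function.onFun, Finset.disjoint_left]
    rintro ⟨a, b⟩ hi hj
    simp only [Finset.mem_filter, Finset.mem_image, Prod.exists, Prod.mk.injEq,
      YoungDiagram.mem_cells] at hi hj
    obtain ⟨⟨p, q, h, rfl, rfl⟩, -⟩ := hi
    obtain ⟨⟨p', q', h', h₁, h₂⟩, -⟩ := hj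
    exact hne (star_index_eq (i := i) h' (by omega) (by omega))

/-- The reading words of the semistandard fillings of `λ^{(1)} * ⋯ * λ^{(r)}`. -/
def starWords (lam : Fin r → YoungDiagram) : Set (List ℕ) :=
  fillingWord (starCells lam) '' {f | IsSemistandardFilling (starCells lam) f}

theorem isCrystal_starWords (lam : Fin r → YoungDiagram) : IsCrystal (starWords lam) :=
  isCrystal_fillingWord (ordConnected_starCells lam)

/-! ### Coefficients of products of Schur functions -/

/-- A semistandard tableau is determined by its reading word. -/
noncomputable def tableauxOfWeightEquiv (μ : YoungDiagram) (d : ℕ →₀ ℕ) :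
    {T : SemistandardYoungTableau μ // ∀ k, fillingWeight μ.cells T k = d k} ≃
      wordsWithPrefix (tableauWords μ) [] fun i => d i := by
  refine Equiv.ofBijective (fun T => ⟨fillingWord μ.cells T.1,
    ⟨_, T.1.isSemistandardFilling, rfl⟩, List.nil_prefix, fun i => ?_⟩) ⟨?_, ?_⟩
  · rw [count_fillingWord, T.2]
  · rintro ⟨T, _⟩ ⟨T', _⟩ h
    have := fillingWord_injOn μ.cells T.isSemistandardFilling T'.isSemistandardFilling
      (congrArg Subtype.val h)
    exact Subtype.ext (SemistandardYoungTableau.ext fun i j => congrFun (congrFun this i) j)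
  · rintro ⟨_, ⟨f, hf, rfl⟩, _, hd⟩
    change IsSemistandardFilling μ.cells f at hf
    refine ⟨⟨⟨f, fun {i j j'} hlt h => hf.row_weak (j := j) ?_ h hlt,
      fun {i i' j} hlt h => hf.col_strict (i := i) ?_ h hlt, fun h => hf.zeros h⟩, fun k => ?_⟩,
      rfl⟩
    · exact μ.up_left_mem le_rfl hlt.le h
    · exact μ.up_left_mem hlt.le le_rfl h
    · have := hd k
      rw [count_fillingWord] at this
      exact Int.ofNat.inj this

theorem coeff_schurFunction (μ : YoungDiagram) (d : ℕ →₀ ℕ) :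
    MvPowerSeries.coeff d (schurFunction μ) =
      Nat.card (wordsWithPrefix (tableauWords μ) [] fun i => d i) := by
  rw [← Nat.card_congr (tableauxOfWeightEquiv μ d)]
  rfl

instance finite_tableaux_of_weight (μ : YoungDiagram) (d : ℕ →₀ ℕ) :
    Finite {T : SemistandardYoungTableau μ // ∀ k, fillingWeight μ.cells T k = d k} :=
  have := (finite_wordsWithPrefix (tableauWords μ) [] fun i => d i).to_subtype
  Finite.of_equiv _ (tableauxOfWeightEquiv μ d).symm

theorem card_starWords_weight (lam : Fin r → YoungDiagram) (d : ℕ →₀ ℕ) :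
    Nat.card (wordsWithPrefix (starWords lam) [] fun i => d i) =
      Nat.card {T : (i : Fin r) → SemistandardYoungTableau (lam i) //
        ∀ k, ∑ i, fillingWeight (lam i).cells (T i) k = d k} := by
  symm
  refine Nat.card_congr (Equiv.ofBijective
    (fun T => ⟨fillingWord (starCells lam) (starFillingOfTuple T.1),
      ⟨_, isSemistandardFilling_starFillingOfTuple T.1, rfl⟩, List.nil_prefix, fun i => ?_⟩)
    ⟨?_, ?_⟩)
  · rw [count_fillingWord, fillingWeight_starFillingOfTuple, T.2]
  · rintro ⟨T, _⟩ ⟨T', _⟩ h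
    exact Subtype.ext (starFillingOfTuple_injective
      (fillingWord_injOn _ (isSemistandardFilling_starFillingOfTuple T)
        (isSemistandardFilling_starFillingOfTuple T') (congrArg Subtype.val h)))
  · rintro ⟨_, ⟨f, hf, rfl⟩, _, hd⟩
    obtain ⟨T, rfl⟩ := exists_starFillingOfTuple_eq hf
    refine ⟨⟨T, fun k => ?_⟩, rfl⟩
    have := hd k
    rw [count_fillingWord, fillingWeight_starFillingOfTuple] at this
    exact Int.ofNat.inj this

/-- The weight of a filling of `S`, as an exponent of a monomial. -/
noncomputable def weightFinsupp (S : Finset (ℕ × ℕ)) (f : ℕ → ℕ → ℕ) : ℕ →₀ ℕ :=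
  Finsupp.onFinset (S.image fun p => f p.1 p.2) (fillingWeight S f) fun k hk => by
    rw [fillingWeight, Finset.card_ne_zero] at hk
    obtain ⟨p, hp⟩ := hk
    rw [Finset.mem_filter] at hp
    exact Finset.mem_image.2 ⟨p, hp⟩

theorem coeff_prod_schurFunction (lam : Fin r → YoungDiagram) (d : ℕ →₀ ℕ) :
    MvPowerSeries.coeff d (∏ i, schurFunction (lam i)) =
      Nat.card (wordsWithPrefix (starWords lam) [] fun i => d i) := by
  classical
  rw [MvPowerSeries.coeff_prod, card_starWords_weight]
  have hcard : Nat.card {T : (i : Fin r) → SemistandardYoungTableau (lam i) //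
      ∀ k, ∑ i, fillingWeight (lam i).cells (T i) k = d k} =
      Nat.card (Σ l : Finset.univ.finsuppAntidiag d, (i : Fin r) →
        {T : SemistandardYoungTableau (lam i) //
          ∀ k, fillingWeight (lam i).cells T k = l.1 i k}) := by
    symm
    refine Nat.card_congr (Equiv.ofBijective (fun x => ⟨fun i => (x.2 i).1, fun k => ?_⟩)
      ⟨?_, ?_⟩)
    · have h := (Finset.mem_finsuppAntidiag.1 x.1.2).1
      have h' := DFunLike.congr_fun h k
      rw [Finsupp.finsetSum_apply] at h'
      rw [← h']
      exact Finset.sum_congr rfl fun i _ => (x.2 i).2 k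
    · rintro ⟨⟨l, hl⟩, t⟩ ⟨⟨l', hl'⟩, t'⟩ h
      have h' : ∀ i, (t i).1 = (t' i).1 := fun i => congrFun (congrArg Subtype.val h) i
      obtain rfl : l = l' := by
        ext i k
        have h₁ := (t i).2 k
        have h₂ := (t' i).2 k
        rw [h' i] at h₁
        exact h₁.symm.trans h₂
      obtain rfl : t = t' := funext fun i => Subtype.ext (h' i)
      rfl
    · rintro ⟨T, hT⟩
      refine ⟨⟨⟨Finsupp.equivFunOnFinite.symm fun i => weightFinsupp (lam i).cells (T i), ?_⟩,
        fun i => ⟨T i, fun k => rfl⟩⟩, rfl⟩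
      rw [Finset.mem_finsuppAntidiag]
      refine ⟨?_, Finset.subset_univ _⟩
      ext k
      rw [Finsupp.finsetSum_apply, ← hT k]
      rfl
  rw [hcard, Nat.card_sigma]
  simp only [Nat.card_pi]
  push_cast
  rw [← Finset.sum_coe_sort (Finset.univ.finsuppAntidiag d)]
  rfl

end Star

/-! ### Expansions of products of Schur functions -/

/-- The weight given by the row lengths of a Young diagram. -/
def YoungDiagram.weight (ν : YoungDiagram) (i : ℕ) : ℤ :=
  ν.rowLen i

theorem YoungDiagram.antitone_weight (ν : YoungDiagram) : Antitone ν.weight :=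
  fun _ _ h => Int.ofNat_le.2 (ν.rowLen_anti _ _ h)

theorem YoungDiagram.rowLen_eq_zero (ν : YoungDiagram) {i : ℕ} (h : ν.colLen 0 ≤ i) :
    ν.rowLen i = 0 := by
  by_contra hne
  have := YoungDiagram.mem_iff_lt_colLen.1
    (YoungDiagram.mem_iff_lt_rowLen.2 (Nat.pos_of_ne_zero hne))
  omega

theorem YoungDiagram.weight_eq_zero (ν : YoungDiagram) {i : ℕ} (h : ν.colLen 0 ≤ i) :
    ν.weight i = 0 := by
  rw [weight, ν.rowLen_eq_zero h, Nat.cast_zero]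

theorem YoungDiagram.exists_weight_eq {N : ℕ} {ν : ℕ → ℤ} (hanti : Antitone ν)
    (h0 : ∀ i, 0 ≤ ν i) (hν : ∀ i, N ≤ i → ν i = 0) : ∃ κ : YoungDiagram, κ.weight = ν := by
  let κ : YoungDiagram :=
    { cells := ((Finset.range N) ×ˢ (Finset.range (ν 0).toNat)).filter fun p =>
        p.2 < (ν p.1).toNat
      isLowerSet := by
        rintro ⟨a, b⟩ ⟨c, d⟩ ⟨h₁, h₂⟩ h
        simp only [Finset.coe_filter, Finset.mem_product, Finset.mem_range,
          Set.mem_ofPred_eq] at h h₁ h₂ ⊢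
        have := hanti h₁
        omega }
  have hmem : ∀ i j, (i, j) ∈ κ ↔ j < (ν i).toNat := by
    intro i j
    rw [← YoungDiagram.mem_cells]
    simp only [κ, Finset.mem_filter, Finset.mem_product, Finset.mem_range]
    have := hanti (Nat.zero_le i)
    refine ⟨fun h => h.2, fun h => ⟨⟨?_, by omega⟩, h⟩⟩
    by_contra hN
    have := hν i (by omega)
    omega
  refine ⟨κ, funext fun i => ?_⟩
  have h1 : κ.rowLen i = (ν i).toNat := by
    refine le_antisymm ?_ ?_
    · by_contra hlt
      have := (hmem i (ν i).toNat).1 (YoungDiagram.mem_iff_lt_rowLen.2 (by omega))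
      omega
    · by_contra hlt
      have := YoungDiagram.mem_iff_lt_rowLen.1 ((hmem i (κ.rowLen i)).2 (by omega))
      omega
  rw [weight, h1, Int.toNat_of_nonneg (h0 i)]

theorem card_words_eq_zero_of_neg {W : Set (List ℕ)} {d : ℕ → ℤ} {i : ℕ} (h : d i < 0) :
    Nat.card (wordsWithPrefix W [] d) = 0 := by
  have : IsEmpty (wordsWithPrefix W [] d) := by
    refine ⟨fun ⟨w, _, _, hw⟩ => ?_⟩
    have := hw i
    omega
  exact Nat.card_of_isEmpty

/-- The multiplicities of the letters of a word have finite support. -/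
theorem exists_finsupp_of_nonempty {W : Set (List ℕ)} {d : ℕ → ℤ}
    (h : (wordsWithPrefix W [] d).Nonempty) : ∃ e : ℕ →₀ ℕ, d = fun i => (e i : ℤ) := by
  obtain ⟨w, _, _, hw⟩ := h
  refine ⟨Finsupp.onFinset w.toFinset (fun i => w.count i) fun i hi => ?_,
    funext fun i => (hw i).symm⟩
  rw [List.mem_toFinset]
  exact List.count_pos_iff.1 (Nat.pos_of_ne_zero hi)

section Expansion

variable {r : ℕ} {lam : Fin r → YoungDiagram}

theorem isSchurExpansion_iff {c : YoungDiagram →₀ ℤ} :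
    IsSchurExpansion lam c ↔ ∀ e : ℕ →₀ ℕ,
      (Nat.card (wordsWithPrefix (starWords lam) [] fun i => e i) : ℤ) =
        c.sum fun μ a => a * Nat.card (wordsWithPrefix (tableauWords μ) [] fun i => e i) := by
  rw [IsSchurExpansion, MvPowerSeries.ext_iff]
  refine forall_congr' fun e => ?_
  have h : ∀ (a : ℤ) (μ : YoungDiagram), MvPowerSeries.coeff e (a • schurFunction μ) =
      a * Nat.card (wordsWithPrefix (tableauWords μ) [] fun i => e i) := fun a μ => by
    rw [map_zsmul, coeff_schurFunction, smul_eq_mul]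
  rw [coeff_prod_schurFunction, Finsupp.sum, Finsupp.sum, map_sum]
  simp only [h]

/-- In an expansion, weight multiplicities agree for all integral weights; only those with
nonnegative coordinates and finite support occur as exponents of monomials. -/
theorem IsSchurExpansion.card_words_eq {c : YoungDiagram →₀ ℤ} (hc : IsSchurExpansion lam c)
    (d : ℕ → ℤ) : (Nat.card (wordsWithPrefix (starWords lam) [] d) : ℤ) =
      c.sum fun μ a => a * Nat.card (wordsWithPrefix (tableauWords μ) [] d) := by
  by_cases h : ∃ e : ℕ →₀ ℕ, d = fun i => (e i : ℤ)
  · obtain ⟨e, rfl⟩ := h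
    exact isSchurExpansion_iff.1 hc e
  · have h0 : ∀ W : Set (List ℕ), Nat.card (wordsWithPrefix W [] d) = 0 := by
      intro W
      have : IsEmpty (wordsWithPrefix W [] d) :=
        ⟨fun w => h (exists_finsupp_of_nonempty ⟨w.1, w.2⟩)⟩
      exact Nat.card_of_isEmpty
    simp [h0]

/-- The alternating sum over the dot action extracts the coefficient of `s_ν`. -/
theorem sum_sign_sum_card_tableauWords (c : YoungDiagram →₀ ℤ) (ν : YoungDiagram) {N : ℕ}
    (hN : ∀ i, N ≤ i → ν.weight i = 0) :
    ∑ σ : Equiv.Perm (Fin N), (Equiv.Perm.sign σ : ℤ) *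
      (c.sum fun μ a => a * Nat.card (wordsWithPrefix (tableauWords μ) []
        (dotAction ν.weight σ))) = c ν := by
  classical
  simp only [Finsupp.sum, Finset.mul_sum]
  rw [Finset.sum_comm]
  have h : ∀ μ : YoungDiagram, ∑ σ : Equiv.Perm (Fin N), (Equiv.Perm.sign σ : ℤ) *
      (c μ * Nat.card (wordsWithPrefix (tableauWords μ) [] (dotAction ν.weight σ))) =
      if μ = ν then c μ else 0 := by
    intro μ
    have h1 := sum_sign_card_words_eq_card_latticeWords (isCrystal_tableauWords μ)
      ν.antitone_weight hN
    have h2 : Nat.card (latticeWords (tableauWords μ) ν.weight) = if μ = ν then 1 else 0 :=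
      card_latticeWords_tableauWords μ ν
    rw [h2] at h1
    simp only [mul_left_comm _ (c μ)]
    rw [← Finset.mul_sum, h1]
    split_ifs <;> simp
  rw [Finset.sum_congr rfl fun μ _ => h μ, Finset.sum_ite_eq']
  split_ifs with hν
  · rfl
  · exact (Finsupp.notMem_support_iff.1 hν).symm

theorem IsSchurExpansion.eq_card_latticeWords {c : YoungDiagram →₀ ℤ}
    (hc : IsSchurExpansion lam c) (ν : YoungDiagram) :
    c ν = Nat.card (latticeWords (starWords lam) ν.weight) := by
  have hN : ∀ i, ν.colLen 0 ≤ i → ν.weight i = 0 := fun i hi => ν.weight_eq_zero hi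
  rw [← sum_sign_sum_card_tableauWords c ν hN,
    ← sum_sign_card_words_eq_card_latticeWords (isCrystal_starWords lam) ν.antitone_weight hN]
  exact Finset.sum_congr rfl fun σ _ => by rw [hc.card_words_eq]

theorem length_of_mem_starWords {w : List ℕ} (hw : w ∈ starWords lam) :
    w.length = (starCells lam).card := by
  obtain ⟨f, _, rfl⟩ := hw
  rw [fillingWord_eq_map, List.length_map, ← List.toFinset_card_of_nodup (nodup_readingCells _),
    toFinset_readingCells]

theorem finite_setOf_nonempty_latticeWords (lam : Fin r → YoungDiagram) :
    {ν : YoungDiagram | (latticeWords (starWords lam) ν.weight).Nonempty}.Finite := by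
  set L := (starCells lam).card
  refine Set.Finite.subset (s := YoungDiagram.cells ⁻¹'
    ((Finset.range L ×ˢ Finset.range L).powerset : Set (Finset (ℕ × ℕ)))) ?_ ?_
  · exact (Finset.finite_toSet _).preimage fun μ _ ν _ h => YoungDiagram.ext h
  · rintro ν ⟨w, hw, hd, -⟩
    have hlen := length_of_mem_starWords hw
    have hcount : ∀ i, w.count i = ν.rowLen i := fun i => Int.ofNat.inj (hd i)
    simp only [Set.mem_preimage, Finset.mem_coe, Finset.mem_powerset]
    rintro ⟨i, j⟩ hij
    rw [YoungDiagram.mem_cells] at hij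
    rw [Finset.mem_product, Finset.mem_range, Finset.mem_range]
    constructor
    · -- all letters up to `i` occur in `w`
      have hsub : Finset.range (i + 1) ⊆ w.toFinset := by
        intro a ha
        rw [Finset.mem_range] at ha
        rw [List.mem_toFinset, ← List.count_pos_iff, hcount]
        exact YoungDiagram.mem_iff_lt_rowLen.1
          (ν.up_left_mem (show a ≤ i by omega) (Nat.zero_le j) hij)
      have h1 := Finset.card_le_card hsub
      rw [Finset.card_range] at h1
      have h2 := w.toFinset_card_le
      simp only
      omega
    · have h1 := YoungDiagram.mem_iff_lt_rowLen.1 hij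
      have h2 := List.count_le_length (a := i) (l := w)
      rw [hcount] at h2
      simp only
      omega

/-- The multiplicities of lattice permutations among the words of `λ^{(1)} * ⋯ * λ^{(r)}`. -/
noncomputable def latticeCoeff (lam : Fin r → YoungDiagram) : YoungDiagram →₀ ℤ :=
  Finsupp.onFinset (finite_setOf_nonempty_latticeWords lam).toFinset
    (fun ν => Nat.card (latticeWords (starWords lam) ν.weight)) fun ν hν => by
      rw [Set.Finite.mem_toFinset]
      change (latticeWords (starWords lam) ν.weight).Nonempty
      by_contra h
      rw [Set.not_nonempty_iff_eq_empty] at h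
      simp [h] at hν

theorem isSchurExpansion_latticeCoeff (lam : Fin r → YoungDiagram) :
    IsSchurExpansion lam (latticeCoeff lam) := by
  rw [isSchurExpansion_iff]
  intro e
  obtain ⟨n, hn⟩ : ∃ n, ∀ i, n + 1 ≤ i → e i = 0 := by
    refine ⟨e.support.sup id, fun i hi => ?_⟩
    by_contra h
    have := Finset.le_sup (f := id) (Finsupp.mem_support_iff.2 h)
    simp only [id] at this
    omega
  have he : (fun i => (e i : ℤ)) = extendWeight fun i : Fin (n + 1) => (e i : ℤ) := by
    funext i
    rcases lt_or_ge i (n + 1) with h | h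
    · exact (extendWeight_apply (fun i : Fin (n + 1) => (e i : ℤ)) ⟨i, h⟩).symm
    · rw [extendWeight_of_le _ h, hn i h, Nat.cast_zero]
  rw [he, ← sub_eq_zero]
  refine eq_zero_of_sum_sign_dotAction_eq_zero (fun d =>
    (Nat.card (wordsWithPrefix (starWords lam) [] d) : ℤ) - (latticeCoeff lam).sum fun μ a =>
      a * Nat.card (wordsWithPrefix (tableauWords μ) [] d)) ?_ ?_ ?_ _
  · intro d i hi
    simp [card_words_eq_zero_of_neg hi]
  · intro d σ
    simp only [card_words_comp_perm (isCrystal_starWords lam),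
      card_words_comp_perm (isCrystal_tableauWords _)]
  · intro ν hanti h0 hν
    obtain ⟨κ, rfl⟩ := YoungDiagram.exists_weight_eq hanti h0 hν
    simp only [mul_sub, Finset.sum_sub_distrib]
    rw [sum_sign_sum_card_tableauWords _ κ hν,
      sum_sign_card_words_eq_card_latticeWords (isCrystal_starWords lam) hanti hν]
    exact sub_self _

/-! ### Lattice tableaux of a tuple of shapes -/

theorem lt_card_of_rowLen_pos {ν : YoungDiagram} {v : ℕ} (h : 0 < ν.rowLen v) : v < ν.card := by
  have hsub : (Finset.range (v + 1)).image (fun i => (i, 0)) ⊆ ν.cells := by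
    intro p hp
    obtain ⟨i, hi, rfl⟩ := Finset.mem_image.1 hp
    rw [Finset.mem_range] at hi
    exact ν.up_left_mem (show i ≤ v by omega) le_rfl (YoungDiagram.mem_iff_lt_rowLen.2 h)
  have := Finset.card_le_card hsub
  rw [Finset.card_image_of_injective _ fun a b h => by simpa using h, Finset.card_range] at this
  exact this

/-- The bound `n` on the entries is no restriction for tableaux whose weight is a partition
of `n`. -/
theorem ncard_SST0 {n : ℕ} {ν : YoungDiagram} (hν : ν.card = n) :
    (SST0 n lam ν).ncard = Nat.card (latticeWords (starWords lam) ν.weight) := by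
  rw [Nat.card_coe_set_eq]
  refine Set.ncard_congr (fun T _ => fillingWord (starCells lam) (starFillingOfTuple T.1))
    ?_ ?_ ?_
  · rintro T ⟨hw, hl⟩
    refine ⟨⟨_, isSemistandardFilling_starFillingOfTuple T.1, rfl⟩, fun i => ?_, hl⟩
    rw [count_fillingWord]
    exact congrArg Int.ofNat (hw i)
  · rintro T T' _ _ h
    exact Subtype.ext (starFillingOfTuple_injective
      (fillingWord_injOn _ (isSemistandardFilling_starFillingOfTuple T.1)
        (isSemistandardFilling_starFillingOfTuple T'.1) h))
  · rintro _ ⟨⟨f, hf, rfl⟩, hd, hl⟩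
    obtain ⟨T, rfl⟩ := exists_starFillingOfTuple_eq hf
    have hd' : ∀ k, fillingWeight (starCells lam) (starFillingOfTuple T) k = ν.rowLen k := by
      intro k
      have := hd k
      rw [count_fillingWord] at this
      exact Int.ofNat.inj this
    refine ⟨⟨T, ?_⟩, ⟨hd', hl⟩, rfl⟩
    rintro i ⟨p, q⟩ hp
    rw [← hν]
    refine lt_card_of_rowLen_pos ?_
    rw [← hd', fillingWeight, Finset.card_pos]
    exact ⟨(p + starRow lam i, q + starCol lam i), Finset.mem_filter.2
      ⟨mem_starCells.2 ⟨i, p, q, hp, rfl, rfl⟩, starFillingOfTuple_apply T i p q⟩⟩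

end Expansion

theorem corollary3p12 (r n : ℕ) (hr : 0 < r) (lam : Fin r → YoungDiagram)
    (hlam : ∑ i, (lam i).card = n) (ν : YoungDiagram) (hν : ν.card = n) :
    (∃! c : YoungDiagram →₀ ℤ, IsSchurExpansion lam c) ∧
      ((SST0 n lam ν).ncard : ℤ) = multiLRCoeff lam ν := by
  have hex : ∃ c, IsSchurExpansion lam c := ⟨_, isSchurExpansion_latticeCoeff lam⟩
  refine ⟨⟨latticeCoeff lam, isSchurExpansion_latticeCoeff lam, fun c hc => ?_⟩, ?_⟩
  · ext μ
    rw [hc.eq_card_latticeWords,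
      (isSchurExpansion_latticeCoeff lam).eq_card_latticeWords]
  · rw [multiLRCoeff, dif_pos hex, hex.choose_spec.eq_card_latticeWords, ncard_SST0 hν]
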